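/- \textbf{Setting.} Let $\mathcal A\neq\emptyset$ (actions) and $\mathcal E$ (percepts) be finite sets; each percept $e\in\mathcal E$ carries a reward $r(e)\in[0,1]$ that is a lower semicomputable real number. Histories are elements $h=a_1e_1\dots a_te_t$ of $\mathcal H=(\mathcal A\times\mathcal E)^*$, and a policy is a function $\pi:\mathcal H\to\mathcal A$. A set of natural numbers is $\Sigma^0_n$ if it has the form $\{k:\exists k_1\forall k_2\cdots Q_nk_n\,S(k,k_1,\dots,k_n)\}$ with $S$ computable, $\Pi^0_n$ if its complement is $\Sigma^0_n$, and $\Delta^0_n$ if it is both; relations on histories, actions, numbers and rationals are classified through a standard encoding into $\mathbb N$. A real-valued function $f$ is lower semicomputable if $\{(x,q):q\in\mathbb Q,\ f(x)>q\}$ is $\Sigma^0_1$. A policy $\pi$ is classified through its graph $\{(h,a):\pi(h)=a\}$, a family $(\pi_m)_{m\in\mathbb N}$ of policies through $\{(m,h,a):\pi_m(h)=a\}$, and \emph{limit computable} means $\Delta^0_2$. An \emph{LSCCCS} (lower semicomputable chronological conditional semimeasure) is a lower semicomputable function $\nu(e_{1:t}\,\|\,a_{1:t})\ge 0$ of the history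 with $\nu(\epsilon)\le 1$ and $\sum_{e\in\mathcal E}\nu(e_{1:t}e\,\|\,a_{1:t}a)\le\nu(e_{1:t}\,\|\,a_{1:t})$ for all histories and all $a\in\mathcal A$; $\mathcal M$ is the set of all LSCCCSs. A discount function is a lower semicomputable $\gamma:\mathbb N\to[0,\infty)$ with $\sum_{t\ge1}\gamma_t<\infty$; put $\Gamma_t=\sum_{i\ge t}\gamma_i$ (it may vanish). The lifetime-$m$ discount is $\gamma_t=1$ for $t\le m$ and $\gamma_t=0$ for $t>m$. The $\nu$-expected (recursive) value of a policy $\pi$ after the history $h=a_1e_1\dots a_{t-1}e_{t-1}$ is \[ W^\pi_\nu(h)=\frac1{\Gamma_t}\sum_{m=t}^\infty\ \sum_{e_t,\dots,e_m\in\mathcal E}\gamma_m\, r(e_m)\,\frac{\nu(e_{1:m}\,\|\,a_{1:m})}{\nu(e_{1:t-1}\,\|\,a_{1:t-1})},\qquad a_i=\pi(a_1e_1\dots a_{i-1}e_{i-1})\ \text{ for } i\ge t, \] with $W^\pi_\nu(h)=0$ if $\Gamma_t=0$ or $\nu(e_{1:t-1}\,\|\,a_{1:t-1})=0$, and $W^*_\nu(h)=\sup_\pi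 W^\pi_\nu(h)$. A \emph{recursive AINU} for $\nu$ is a policy $\pi$ with $W^\pi_\nu(h)=W^*_\nu(h)$ for all $h\in\mathcal H$; it is \emph{$\varepsilon$-optimal} if $W^*_\nu(h)-W^\pi_\nu(h)<\varepsilon$ for all $h\in\mathcal H$. A universal monotone (chronological) Turing machine $U$ simulates $T_i$ on $p$ when given the input $\langle i\rangle p$, where $T_0,T_1,\dots$ is an effective enumeration of all monotone chronological Turing machines (which read input bits from a one-way tape, receive actions and emit percepts, the percept of step $s$ before the action of step $s+1$ is received; they may fail to produce even the empty output) and $i\mapsto\langle i\rangle\in\{0,1\}^*$ is a computable prefix-free code. Let $\lambda_T(e_{1:t}\,\|\,a_{1:t})$ be the probability that $T$, on uniformly random input bits and actions $a_{1:t}$, emits (at least) $e_{1:t}$. The universal prior given by $U$ is $w_\nu=\sum_{i:\lambda_{T_i}=\nu}2^{-|\langle i\rangle|}$, the universal mixture is $\xi=\sum_{\nu\in\mathcal M}w_\nu\,\nu$, and \emph{recursive AIXI} is recursive AINU for the environment $\xi$. \textbf{Corollary (Complexity of Recursive AINU/AIXI).} For every $\nu\in\mathcal M$: \begin{enumerate}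 \item for every discount function $\gamma$ there is a recursive AINU for $\nu$ that is $\Delta^0_3$, and for every $\varepsilon>0$ there is an $\varepsilon$-optimal recursive AINU for $\nu$ that is $\Delta^0_2$; \item (finite lifetime, uniformly in the lifetime) there is a $\Delta^0_3$ family $(\pi_m)_{m\in\mathbb N}$ such that each $\pi_m$ is a recursive AINU for $\nu$ with the lifetime-$m$ discount, and for every $\varepsilon>0$ there is a $\Delta^0_2$ family $(\pi_m)_{m\in\mathbb N}$ such that each $\pi_m$ is an $\varepsilon$-optimal recursive AINU for $\nu$ with the lifetime-$m$ discount. \end{enumerate} In particular, for every universal monotone Turing machine $U$ with universal mixture $\xi$, the same holds for $\xi$ in place of $\nu$: there is a recursive AIXI that is $\Delta^0_3$, and for every $\varepsilon>0$ there is an $\varepsilon$-optimal recursive AIXI (with infinite horizon for an arbitrary discount function, or as a family indexed by the lifetime) that is limit computable. -/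

import Mathlib

/-! ### The arithmetical hierarchy -/

/-- A block of `n` alternating number quantifiers in front of `S`; it starts with `∃` if the flag is
`true` and with `∀` if it is `false`. -/
def AltQuant : Bool → ℕ → (List ℕ → Prop) → Prop
  | _, 0, S => S []
  | true, n + 1, S => ∃ k, AltQuant false n (fun l => S (k :: l))
  | false, n + 1, S => ∀ k, AltQuant true n (fun l => S (k :: l))

/-- `X ⊆ ℕ` is `Σ⁰ₙ`: `k ∈ X ↔ ∃ k₁ ∀ k₂ … Qₙ kₙ, S (k, k₁, …, kₙ)` with `S` computable. -/
def IsSigmaSet (n : ℕ) (X : Set ℕ) : Prop :=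
  ∃ S : ℕ → List ℕ → Prop, ComputablePred (fun x : ℕ × List ℕ => S x.1 x.2) ∧
    ∀ k, k ∈ X ↔ AltQuant true n (S k)

/-- `X ⊆ ℕ` is `Π⁰ₙ`. -/
def IsPiSet (n : ℕ) (X : Set ℕ) : Prop := IsSigmaSet n Xᶜ

/-- `X ⊆ ℕ` is `Δ⁰ₙ`. -/
def IsDeltaSet (n : ℕ) (X : Set ℕ) : Prop := IsSigmaSet n X ∧ IsPiSet n X

/-- The set of natural numbers that encodes a relation on an encodable type. -/
def codeSet {α : Type*} [Primcodable α] (p : α → Prop) : Set ℕ :=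
  {k | ∃ x, p x ∧ Encodable.encode x = k}

/-- A relation is `Δ⁰ₙ` if the set of natural numbers that encodes it is. -/
def IsDelta {α : Type*} [Primcodable α] (n : ℕ) (p : α → Prop) : Prop :=
  IsDeltaSet n (codeSet p)

/-- Limit computable means `Δ⁰₂`. -/
def IsLimitComputable {α : Type*} [Primcodable α] (p : α → Prop) : Prop := IsDelta 2 p

/-- The rational number `(a - b) / (c + 1)` with code `(a, b, c)`. -/
def ratOfCode (x : ℕ × ℕ × ℕ) : ℚ := ((x.1 : ℚ) - (x.2.1 : ℚ)) / ((x.2.2 : ℚ) + 1)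

/-- A real-valued function `f` is lower semicomputable if `{(x, q) | f x > q}` is `Σ⁰₁`. -/
def LowerSemicomputable {α : Type*} [Primcodable α] (f : α → ℝ) : Prop :=
  IsSigmaSet 1 (codeSet fun x : α × (ℕ × ℕ × ℕ) => f x.1 > (ratOfCode x.2 : ℝ))

/-! ### Histories, environments, policies -/

/-- Histories `a₁ e₁ … aₜ eₜ`: finite sequences of pairs of an action and a percept. -/
abbrev Hist (A E : Type*) := List (A × E)

/-- A policy maps each history to the action taken next. -/
abbrev Policy (A E : Type*) := Hist A E → A

/-- `ν` is a lower semicomputable chronological conditional semimeasure (LSCCCS). Since `ν` is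
chronological, `ν(e₁…eₜ ‖ a₁a₂…)` depends on the actions `a₁…aₜ` only; it is `ν` at the history
`a₁ e₁ … aₜ eₜ`. -/
structure IsLSCCCS {A E : Type*} [Fintype E] [Primcodable A] [Primcodable E]
    (ν : Hist A E → ℝ) : Prop where
  nonneg : ∀ h, 0 ≤ ν h
  nil_le : ν [] ≤ 1
  sum_le : ∀ h a, ∑ e, ν (h ++ [(a, e)]) ≤ ν h
  lsc : LowerSemicomputable ν

/-- `γ` is a discount function: nonnegative, summable and lower semicomputable. The time steps are
`1, 2, 3, …`, so that the value `γ 0` plays no role. -/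
structure IsDiscount (γ : ℕ → ℝ) : Prop where
  nonneg : ∀ t, 0 ≤ γ t
  summable : Summable γ
  lsc : LowerSemicomputable γ

/-- The discount function of the finite lifetime `m`. -/
noncomputable def lifetimeDiscount (m : ℕ) (t : ℕ) : ℝ := if t ≤ m then 1 else 0

/-- The discount normalization factor `Γₜ = γₜ + γₜ₊₁ + …`. -/
noncomputable def discountNorm (γ : ℕ → ℝ) (t : ℕ) : ℝ := ∑' i, γ (t + i)

/-- The history that arises from `h` when the actions are chosen by `π` and the further percepts
are those in the list. -/
def playOut {A E : Type*} (π : Policy A E) : Hist A E → List E → Hist A E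
  | h, [] => h
  | h, e :: es => playOut π (h ++ [(π h, e)]) es

/-- The `ν`-expected value `W` of the policy `π` after the history `h`, where `t = |h| + 1` is the
current time step:
`(1 / Γₜ) ∑_{m ≥ t} ∑_{eₜ…eₘ} γₘ rₘ ν(e₁…eₘ | e₁…eₜ₋₁ ‖ a₁…aₘ)`, and `0` if `Γₜ = 0`.
The summation index is `k = m - t`. The conditional probability is the quotient
`ν(e₁…eₘ ‖ a₁…aₘ) / ν(e₁…eₜ₋₁ ‖ a₁…aₜ₋₁)`, read as `0` if the denominator is `0`. -/
noncomputable def valueW {A E : Type*} [Fintype E] (r : E → ℝ) (γ : ℕ → ℝ) (ν : Hist A E → ℝ)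
    (π : Policy A E) (h : Hist A E) : ℝ :=
  if discountNorm γ (h.length + 1) = 0 then 0
  else 1 / discountNorm γ (h.length + 1) *
    ∑' k : ℕ, ∑ es : Fin (k + 1) → E,
      γ (h.length + 1 + k) * r (es (Fin.last k)) * (ν (playOut π h (List.ofFn es)) / ν h)

/-- The optimal `ν`-expected value. -/
noncomputable def optValueW {A E : Type*} [Fintype E] (r : E → ℝ) (γ : ℕ → ℝ) (ν : Hist A E → ℝ)
    (h : Hist A E) : ℝ :=
  ⨆ π : Policy A E, valueW r γ ν π h

/-- `π` is a recursive AINU for the environment `ν`: it attains the optimal `ν`-expected value after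
every history. -/
def IsOptimal {A E : Type*} [Fintype E] (r : E → ℝ) (γ : ℕ → ℝ) (ν : Hist A E → ℝ)
    (π : Policy A E) : Prop :=
  ∀ h, valueW r γ ν π h = optValueW r γ ν h

/-- `π` is an `ε`-optimal recursive AINU for the environment `ν`. -/
def IsEpsOptimal {A E : Type*} [Fintype E] (r : E → ℝ) (γ : ℕ → ℝ) (ν : Hist A E → ℝ) (ε : ℝ)
    (π : Policy A E) : Prop :=
  ∀ h, optValueW r γ ν h - valueW r γ ν π h < ε

/-- A policy as a relation on histories and actions. -/
def policyGraph {A E : Type*} (π : Policy A E) : Hist A E × A → Prop := fun x => π x.1 = x.2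

/-- A family of policies, indexed by the lifetime, as a relation on lifetimes, histories and
actions. -/
def policyFamilyGraph {A E : Type*} (π : ℕ → Policy A E) : ℕ × Hist A E × A → Prop :=
  fun x => π x.1 x.2.1 = x.2.2

/-! ### Universal monotone machines and the universal mixture -/

/-- The input-output behaviour of a monotone chronological Turing machine, which reads input bits
from a one-way tape, receives actions and emits percepts: `Produces p (a₁ e₁ … aₜ eₜ)` says that,
having read no more than the input `p` and having received the actions `a₁, …, aₜ`, the machine has
emitted (at least) the percepts `e₁, …, eₜ`, where `eₛ` is emitted before `aₛ₊₁` is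
received. (The machine is partial: it need not produce even the empty output.) -/
@[ext]
structure MonotoneMachine (A E : Type*) [Primcodable A] [Primcodable E] where
  Produces : List Bool → Hist A E → Prop
  re : REPred fun x : List Bool × Hist A E => Produces x.1 x.2
  mono : ∀ p q h, p <+: q → Produces p h → Produces q h
  chronological : ∀ p h x, Produces p (h ++ [x]) → Produces p h
  functional : ∀ p h a e e',
    Produces p (h ++ [(a, e)]) → Produces p (h ++ [(a, e')]) → e = e'

/-- The chronological semimeasure of a machine: the probability that it emits the percepts of `h`
on the actions of `h` when it is fed with uniformly random bits, that is, the supremum (and limit)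
over `n` of the fraction of the inputs of length `n` with this output. -/
noncomputable def MonotoneMachine.semimeasure {A E : Type*} [Primcodable A] [Primcodable E]
    (T : MonotoneMachine A E) (h : Hist A E) : ℝ :=
  ⨆ n : ℕ, (Nat.card {p : Fin n → Bool // T.Produces (List.ofFn p) h} : ℝ) / 2 ^ n

/-- A universal monotone chronological Turing machine: on input `⟨i⟩ p` it simulates the machine
`Tᵢ` on input `p`, where `T₀, T₁, …` is an effective enumeration of all monotone chronological
machines and `i ↦ ⟨i⟩` is a computable self-delimiting code. -/
structure UniversalMachine (A E : Type*) [Primcodable A] [Primcodable E] extends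
    MonotoneMachine A E where
  enum : ℕ → MonotoneMachine A E
  enum_re : REPred fun x : ℕ × List Bool × Hist A E => (enum x.1).Produces x.2.1 x.2.2
  enum_surjective : Function.Surjective enum
  code : ℕ → List Bool
  code_computable : Computable code
  code_prefixFree : ∀ i j, code i <+: code j → i = j
  simulates : ∀ i p h, Produces (code i ++ p) h ↔ (enum i).Produces p h

/-- The universal prior given by `U`: the weight of `ν` is the sum of `2 ^ (-|⟨i⟩|)` over all `i`
such that the machine with index `i` has the semimeasure `ν`. -/
noncomputable def UniversalMachine.prior {A E : Type*} [Primcodable A] [Primcodable E]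
    (U : UniversalMachine A E) (ν : Hist A E → ℝ) : ℝ :=
  ∑' i : {i : ℕ // (U.enum i).semimeasure = ν}, (1 / 2 : ℝ) ^ (U.code i).length

/-- The universal mixture `ξ = ∑ w_ν ν` over all LSCCCSs `ν`, with the universal prior `w`
given by `U`. -/
noncomputable def UniversalMachine.mixture {A E : Type*} [Fintype E] [Primcodable A]
    [Primcodable E] (U : UniversalMachine A E) (h : Hist A E) : ℝ :=
  ∑' ν : {ν : Hist A E → ℝ // IsLSCCCS ν}, U.prior ν.1 * ν.1 h

open Encodable

open scoped ENNReal

/-! ### Computable predicates -/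

namespace ComputablePred

variable {α β : Type*} [Primcodable α] [Primcodable β]

theorem comp {p : β → Prop} (hp : ComputablePred p) {f : α → β} (hf : Computable f) :
    ComputablePred fun x => p (f x) := by
  obtain ⟨_, hp⟩ := hp
  exact (hp.comp hf).computablePred

theorem and {p q : α → Prop} (hp : ComputablePred p) (hq : ComputablePred q) :
    ComputablePred fun x => p x ∧ q x := by
  obtain ⟨_, hp⟩ := hp
  obtain ⟨_, hq⟩ := hq
  exact ((Primrec.and.to_comp.comp hp hq).of_eq fun x => by simp).computablePred

theorem or {p q : α → Prop} (hp : ComputablePred p) (hq : ComputablePred q) :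
    ComputablePred fun x => p x ∨ q x := by
  obtain ⟨_, hp⟩ := hp
  obtain ⟨_, hq⟩ := hq
  exact ((Primrec.or.to_comp.comp hp hq).of_eq fun x => by simp).computablePred

theorem option_elim {p : α × β → Prop} (hp : ComputablePred p) {o : α → Option β}
    (ho : Computable o) (c : Prop) :
    ComputablePred fun x => (o x).elim c fun b => p (x, b) := by
  classical
  obtain ⟨f, hf, rfl⟩ := computable_iff.1 hp
  refine computable_iff.2 ⟨fun x => Option.casesOn (o x) (decide c) fun b => f (x, b),
    Computable.option_casesOn (g := fun x b => f (x, b)) ho (Computable.const (decide c)) hf, ?_⟩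
  funext x
  cases h : o x <;> simp [h]

theorem forall_lt {p : α × ℕ → Prop} (hp : ComputablePred p) {b : α → ℕ} (hb : Computable b) :
    ComputablePred fun x => ∀ i < b x, p (x, i) := by
  obtain ⟨f, hf, rfl⟩ := computable_iff.1 hp
  refine computable_iff.2 ⟨fun x => Nat.rec true (fun i r => f (x, i) && r) (b x),
    Computable.nat_rec (h := fun x y => f (x, y.1) && y.2) hb
      (Computable.const true)
      (Computable₂.mk (Primrec.and.to_comp.comp
        (hf.comp (Computable.fst.pair (Computable.fst.comp Computable.snd)))
        (Computable.snd.comp Computable.snd))), ?_⟩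
  funext x
  beta_reduce
  generalize b x = n
  induction n with
  | zero => simp
  | succ n ih =>
    simp only [Nat.forall_lt_succ_right, eq_iff_iff] at ih ⊢
    rw [ih]
    simp [and_comm]

end ComputablePred

theorem PrimrecRel.computablePred_comp {α β γ : Type*} [Primcodable α] [Primcodable β]
    [Primcodable γ] {R : β → γ → Prop} (hR : PrimrecRel R) {f : α → β} {g : α → γ}
    (hf : Computable f) (hg : Computable g) : ComputablePred fun x => R (f x) (g x) :=
  (PrimrecPred.computablePred hR).comp (f := fun x => (f x, g x)) (hf.pair hg)

/-! ### The arithmetical hierarchy on encodable types -/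

/-- The predicate `p` is `Σ⁰ₙ`. -/
def SigmaPred : (n : ℕ) → {α : Type u} → [Primcodable α] → (α → Prop) → Prop
  | 0, _, _, p => ComputablePred p
  | n + 1, α, _, p => ∃ T : α × ℕ → Prop, SigmaPred n T ∧ ∀ x, p x ↔ ∃ k, ¬ T (x, k)

namespace SigmaPred

variable {α : Type u} {β : Type v} [Primcodable α] [Primcodable β] {n : ℕ}

theorem of_eq {p q : α → Prop} (hp : SigmaPred n p) (h : ∀ x, p x ↔ q x) : SigmaPred n q :=
  (funext fun a => propext (h a) : p = q) ▸ hp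

theorem comp : ∀ {n : ℕ} {α : Type u} {β : Type v} [Primcodable α] [Primcodable β] {p : β → Prop},
    SigmaPred n p → ∀ {f : α → β}, Computable f → SigmaPred n fun x => p (f x)
  | 0, _, _, _, _, _, hp, _, hf => ComputablePred.comp hp hf
  | _ + 1, _, _, _, _, _, ⟨T, hT, h⟩, f, hf =>
    ⟨fun y => T (f y.1, y.2), hT.comp ((hf.comp Computable.fst).pair Computable.snd),
      fun x => h (f x)⟩

theorem and_or : ∀ {n : ℕ} {α : Type u} [Primcodable α] {p q : α → Prop},
    SigmaPred n p → SigmaPred n q →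
      SigmaPred n (fun x => p x ∧ q x) ∧ SigmaPred n (fun x => p x ∨ q x)
  | 0, _, _, _, _, hp, hq => ⟨ComputablePred.and hp hq, ComputablePred.or hp hq⟩
  | _ + 1, _, _, _, _, ⟨T, hT, h⟩, ⟨T', hT', h'⟩ => by
    refine ⟨⟨fun y => T (y.1, y.2.unpair.1) ∨ T' (y.1, y.2.unpair.2), ?_, fun x => ?_⟩,
      ⟨fun y => T y ∧ T' y, (hT.and_or hT').1, fun x => ?_⟩⟩
    · have hu := Computable.unpair
      exact (and_or
        (hT.comp (Computable.fst.pair (Computable.fst.comp (hu.comp Computable.snd))))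
        (hT'.comp (Computable.fst.pair (Computable.snd.comp (hu.comp Computable.snd))))).2
    · simp only [h, h']
      constructor
      · rintro ⟨⟨k, hk⟩, l, hl⟩
        exact ⟨Nat.pair k l, by simp [hk, hl]⟩
      · rintro ⟨k, hk⟩
        rw [not_or] at hk
        exact ⟨⟨_, hk.1⟩, _, hk.2⟩
    · simp only [h, h', ← exists_or]
      exact exists_congr fun k => not_and_or.symm

theorem and {p q : α → Prop} (hp : SigmaPred n p) (hq : SigmaPred n q) :
    SigmaPred n fun x => p x ∧ q x := (hp.and_or hq).1

theorem or {p q : α → Prop} (hp : SigmaPred n p) (hq : SigmaPred n q) :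
    SigmaPred n fun x => p x ∨ q x := (hp.and_or hq).2

theorem not {p : α → Prop} (hp : SigmaPred n p) : SigmaPred (n + 1) fun x => ¬ p x :=
  ⟨fun y => p y.1, hp.comp Computable.fst, fun _ => by simp⟩

theorem succ : ∀ {n : ℕ} {α : Type u} [Primcodable α] {p : α → Prop},
    SigmaPred n p → SigmaPred (n + 1) p
  | 0, _, _, _, hp => (not (n := 0) (ComputablePred.not hp)).of_eq fun _ => not_not
  | _ + 1, _, _, _, ⟨T, hT, h⟩ => ⟨T, hT.succ, h⟩

theorem of_computablePred {p : α → Prop} (hp : ComputablePred p) : SigmaPred n p := by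
  induction n with
  | zero => exact hp
  | succ n ih => exact ih.succ

theorem exists_nat {p : α × ℕ → Prop} (hp : SigmaPred (n + 1) p) :
    SigmaPred (n + 1) fun x => ∃ k, p (x, k) := by
  obtain ⟨T, hT, h⟩ := hp
  have hu := Computable.unpair.comp (Computable.snd (α := α) (β := ℕ))
  refine ⟨fun y => T ((y.1, y.2.unpair.1), y.2.unpair.2), hT.comp
    ((Computable.fst.pair (Computable.fst.comp hu)).pair (Computable.snd.comp hu)), fun x => ?_⟩
  simp only [h]
  constructor
  · rintro ⟨k, l, hl⟩
    exact ⟨Nat.pair k l, by simpa using hl⟩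
  · rintro ⟨k, hk⟩
    exact ⟨_, _, hk⟩

theorem option_elim : ∀ {n : ℕ} {α : Type u} {β : Type v} [Primcodable α] [Primcodable β]
    {p : α × β → Prop}, SigmaPred n p → ∀ {o : α → Option β}, Computable o → ∀ c : Prop,
      SigmaPred n fun x => (o x).elim c fun b => p (x, b)
  | 0, _, _, _, _, _, hp, _, ho, c => ComputablePred.option_elim hp ho c
  | _ + 1, α, β, _, _, p, ⟨T, hT, h⟩, o, ho, c => by
    have hc : Computable fun y : (α × ℕ) × β => ((y.1.1, y.2), y.1.2) :=
      ((Computable.fst.comp Computable.fst).pair Computable.snd).pair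
        (Computable.snd.comp Computable.fst)
    refine ⟨_, (hT.comp hc).option_elim (ho.comp Computable.fst) (¬ c), fun x => ?_⟩
    cases h' : o x <;> simp [h', h]

theorem bounded : ∀ {n : ℕ} {α : Type u} [Primcodable α] {p : α × ℕ → Prop},
    SigmaPred n p → ∀ {b : α → ℕ}, Computable b →
      SigmaPred n (fun x => ∀ i < b x, p (x, i)) ∧ SigmaPred n (fun x => ∃ i < b x, p (x, i))
  | 0, _, _, p, hp, b, hb => by
    refine ⟨ComputablePred.forall_lt hp hb, ?_⟩
    refine (ComputablePred.not (ComputablePred.forall_lt (ComputablePred.not hp) hb)).of_eq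
      fun x => ?_
    push Not
    rfl
  | n + 1, α, _, p, hp, b, hb => by
    constructor
    · obtain ⟨T, hT, h⟩ := hp
      have hl : Computable fun y : (α × ℕ) × ℕ =>
          (((Denumerable.ofNat (List ℕ) y.1.2)[y.2]?).getD 0) :=
        Computable.option_getD (Computable.list_getElem?.comp
          ((Computable.ofNat (List ℕ)).comp (Computable.snd.comp Computable.fst)) Computable.snd)
          (Computable.const 0)
      have hT' := (hT.comp
        (((Computable.fst.comp Computable.fst).pair Computable.snd).pair hl))
      refine ⟨_, (hT'.bounded (hb.comp Computable.fst)).2, fun x => ?_⟩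
      simp only [h]
      constructor
      · intro hx
        choose f hf using hx
        refine ⟨encode ((List.range (b x)).pmap f fun i => List.mem_range.1), ?_⟩
        push Not
        intro i hi
        simpa [hi] using hf i hi
      · rintro ⟨k, hk⟩ i hi
        push Not at hk
        exact ⟨_, hk i hi⟩
    · have hlt : SigmaPred (n + 1) fun y : α × ℕ => y.2 < b y.1 :=
        of_computablePred (Primrec.nat_lt.computablePred_comp Computable.snd
          (hb.comp Computable.fst))
      exact (hlt.and hp).exists_nat

theorem forall_lt {p : α × ℕ → Prop} (hp : SigmaPred n p) {b : α → ℕ} (hb : Computable b) :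
    SigmaPred n (fun x => ∀ i < b x, p (x, i)) := (hp.bounded hb).1

end SigmaPred

theorem not_altQuant : ∀ (b : Bool) (n : ℕ) (S : List ℕ → Prop),
    (¬ AltQuant b n S) ↔ AltQuant (!b) n fun l => ¬ S l
  | _, 0, _ => Iff.rfl
  | true, n + 1, S => by
    simp only [AltQuant, not_exists, Bool.not_true]
    exact forall_congr' fun k => not_altQuant _ _ _
  | false, n + 1, S => by
    simp only [AltQuant, not_forall, Bool.not_false]
    exact exists_congr fun k => not_altQuant _ _ _

theorem SigmaPred.exists_altQuant : ∀ {n : ℕ} {α : Type u} [Primcodable α] {p : α → Prop},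
    SigmaPred n p → ∃ S : α × List ℕ → Prop, ComputablePred S ∧
      ∀ x, p x ↔ AltQuant true n fun l => S (x, l)
  | 0, _, _, p, hp => ⟨fun y => p y.1, ComputablePred.comp hp Computable.fst, fun _ => Iff.rfl⟩
  | n + 1, α, _, p, ⟨T, hT, h⟩ => by
    obtain ⟨S, hS, hST⟩ := hT.exists_altQuant
    have hc : Computable fun y : (α × List ℕ) × ℕ => ((y.1.1, y.2), y.1.2.tail) :=
      ((Computable.fst.comp Computable.fst).pair Computable.snd).pair
        (Primrec.list_tail.to_comp.comp (Computable.snd.comp Computable.fst))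
    refine ⟨_, (hS.comp hc).not.option_elim
      (Primrec.list_head?.to_comp.comp Computable.snd) False, fun x => ?_⟩
    rw [h]
    refine exists_congr fun k => ?_
    rw [hST, not_altQuant]
    rfl

theorem SigmaPred.isSigmaSet {n : ℕ} {p : ℕ → Prop} (hp : SigmaPred n p) :
    IsSigmaSet n {k | p k} := by
  obtain ⟨S, hS, h⟩ := hp.exists_altQuant
  exact ⟨fun k l => S (k, l), hS, h⟩

/-- A predicate that is both `Σ⁰ₙ` and `Π⁰ₙ`. -/
def DeltaPred {α : Type u} [Primcodable α] (n : ℕ) (p : α → Prop) : Prop :=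
  SigmaPred n p ∧ SigmaPred n fun x => ¬ p x

theorem DeltaPred.comp {α : Type u} {β : Type v} [Primcodable α] [Primcodable β] {n : ℕ}
    {p : β → Prop} (hp : DeltaPred n p) {f : α → β} (hf : Computable f) :
    DeltaPred n fun x => p (f x) :=
  ⟨hp.1.comp hf, hp.2.comp hf⟩

theorem SigmaPred.isSigmaSet_decode₂ {α : Type u} [Primcodable α] {n : ℕ} {p : α → Prop}
    (hp : SigmaPred n p) (c : Prop) : IsSigmaSet n {k | (decode₂ α k).elim c p} :=
  ((hp.comp Computable.snd).option_elim (α := ℕ) Primrec.decode₂.to_comp c).isSigmaSet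

theorem mem_codeSet {α : Type u} [Primcodable α] {p : α → Prop} {k : ℕ} :
    k ∈ codeSet p ↔ (decode₂ α k).elim False p := by
  simp only [codeSet, Set.mem_ofPred_eq]
  constructor
  · rintro ⟨x, hx, hxk⟩
    simpa [decode₂_eq_some.2 hxk] using hx
  · cases h : decode₂ α k with
    | none => simp
    | some x => exact fun hx => ⟨x, hx, decode₂_eq_some.1 h⟩

theorem SigmaPred.isSigmaSet_codeSet {α : Type u} [Primcodable α] {n : ℕ} {p : α → Prop}
    (hp : SigmaPred n p) : IsSigmaSet n (codeSet p) := by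
  convert hp.isSigmaSet_decode₂ False using 1
  exact Set.ext fun k => mem_codeSet

theorem DeltaPred.isDelta {α : Type u} [Primcodable α] {n : ℕ} {p : α → Prop}
    (hp : DeltaPred n p) : IsDelta n p := by
  refine ⟨hp.1.isSigmaSet_codeSet, ?_⟩
  unfold IsPiSet
  convert hp.2.isSigmaSet_decode₂ True using 1
  ext k
  rw [Set.mem_compl_iff, mem_codeSet]
  cases h : decode₂ α k <;> simp [h]

/-- A total `Σ⁰ₙ₊₁` relation contains the graph of a function, and this graph is `Δ⁰ₙ₊₁`. -/
theorem SigmaPred.exists_choice {α : Type u} {β : Type v} [Primcodable α] [Primcodable β] {n : ℕ}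
    {R : α × β → Prop} (hR : SigmaPred (n + 1) R) (htot : ∀ x, ∃ b, R (x, b)) :
    ∃ f : α → β, (∀ x, R (x, f x)) ∧ DeltaPred (n + 1) fun y : α × β => f y.1 = y.2 := by
  classical
  obtain ⟨T, hT, h⟩ := hR
  let Q : α × ℕ → Prop := fun y => (decode (α := β × ℕ) y.2).elim True
    fun z => T ((y.1, z.1), z.2)
  have hQ : SigmaPred n Q := by
    have hc : Computable fun z : (α × ℕ) × (β × ℕ) => ((z.1.1, z.2.1), z.2.2) :=
      ((Computable.fst.comp Computable.fst).pair (Computable.fst.comp Computable.snd)).pair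
        (Computable.snd.comp Computable.snd)
    exact (hT.comp hc).option_elim (Computable.decode.comp Computable.snd) True
  have hex : ∀ x, ∃ m, ¬ Q (x, m) := fun x => by
    obtain ⟨b, hb⟩ := htot x
    obtain ⟨k, hk⟩ := (h _).1 hb
    exact ⟨encode (b, k), by simpa [Q] using hk⟩
  have hdec : ∀ x, ∃ b k, decode (α := β × ℕ) (Nat.find (hex x)) = some (b, k) ∧
      ¬ T ((x, b), k) := fun x => by
    have : ¬ (decode (α := β × ℕ) (Nat.find (hex x))).elim True fun z => T ((x, z.1), z.2) :=
      Nat.find_spec (hex x)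
    cases hd : decode (α := β × ℕ) (Nat.find (hex x)) with
    | none => rw [hd] at this; exact absurd trivial this
    | some z => exact ⟨z.1, z.2, rfl, by rwa [hd] at this⟩
  choose f g hfg hT' using hdec
  refine ⟨f, fun x => (h _).2 ⟨g x, hT' x⟩, ?_⟩
  have key : ∀ C : (α × β) × ℕ → Prop, ComputablePred C →
      SigmaPred (n + 1) fun y : α × β => C (y, Nat.find (hex y.1)) := fun C hC => by
    have hx : Computable fun y : (α × β) × ℕ => (y.1.1, y.2) :=
      (Computable.fst.comp Computable.fst).pair Computable.snd
    have hx' : Computable fun y : ((α × β) × ℕ) × ℕ => (y.1.1.1, y.2) :=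
      (Computable.fst.comp (Computable.fst.comp Computable.fst)).pair Computable.snd
    have h1 := (hQ.comp hx).not
    have h2 := ((hQ.comp hx').forall_lt (b := fun y : (α × β) × ℕ => y.2) Computable.snd).succ
    refine ((h1.and h2).and (SigmaPred.of_computablePred hC)).exists_nat.of_eq fun y => ?_
    constructor
    · rintro ⟨m, ⟨hm, hlt⟩, hCm⟩
      have : Nat.find (hex y.1) = m :=
        (Nat.find_eq_iff _).2 ⟨hm, fun i hi => not_not.2 (hlt i hi)⟩
      rwa [this]
    · exact fun hC => ⟨_, ⟨Nat.find_spec (hex y.1), fun i hi => not_not.1 (Nat.find_min _ hi)⟩, hC⟩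
  have hC : ComputablePred fun y : (α × β) × ℕ =>
      ((decode (α := β × ℕ) y.2).map Prod.fst) = some y.1.2 :=
    Primrec.eq.computablePred_comp
      (Computable.option_map (Computable.decode.comp Computable.snd)
        (Computable₂.mk (Computable.fst.comp Computable.snd)))
      (Computable.option_some.comp (Computable.snd.comp Computable.fst))
  constructor
  · exact (key _ hC).of_eq fun y => by simp [hfg]
  · exact (key _ hC.not).of_eq fun y => by simp [hfg]

/-! ### Lower semicomputable functions with values in `[0, ∞]` -/

/-- The nonnegative rational number with code `(a, b)`, that is, `a / (b + 1)`. -/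
noncomputable def fracOfCode (p : ℕ × ℕ) : ℝ≥0∞ := (p.1 : ℝ≥0∞) / ((p.2 : ℝ≥0∞) + 1)

theorem fracOfCode_eq_coe (p : ℕ × ℕ) :
    fracOfCode p = (((p.1 : NNReal) / ((p.2 : NNReal) + 1) : NNReal) : ℝ≥0∞) := by
  rw [ENNReal.coe_div (by positivity)]
  simp [fracOfCode]

theorem fracOfCode_eq_ofReal (p : ℕ × ℕ) :
    fracOfCode p = ENNReal.ofReal ((p.1 : ℝ) / ((p.2 : ℝ) + 1)) := by
  rw [fracOfCode_eq_coe, ← ENNReal.ofReal_coe_nnreal]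
  simp

@[simp]
theorem fracOfCode_zero (n : ℕ) : fracOfCode (0, n) = 0 := by simp [fracOfCode]

theorem fracOfCode_add (p q : ℕ × ℕ) : fracOfCode p + fracOfCode q =
    fracOfCode (p.1 * (q.2 + 1) + q.1 * (p.2 + 1), p.2 * q.2 + p.2 + q.2) := by
  simp only [fracOfCode_eq_coe, ← ENNReal.coe_add, ENNReal.coe_inj]
  push_cast
  have : (p.2 * q.2 + p.2 + q.2 + 1 : NNReal) = (p.2 + 1) * (q.2 + 1) := by ring
  rw [this]
  field_simp

theorem fracOfCode_mul (p q : ℕ × ℕ) : fracOfCode p * fracOfCode q =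
    fracOfCode (p.1 * q.1, p.2 * q.2 + p.2 + q.2) := by
  simp only [fracOfCode_eq_coe, ← ENNReal.coe_mul, ENNReal.coe_inj]
  push_cast
  have : (p.2 * q.2 + p.2 + q.2 + 1 : NNReal) = (p.2 + 1) * (q.2 + 1) := by ring
  rw [this]
  field_simp

theorem fracOfCode_lt_iff (p q : ℕ × ℕ) :
    fracOfCode p < fracOfCode q ↔ p.1 * (q.2 + 1) < q.1 * (p.2 + 1) := by
  rw [fracOfCode_eq_coe, fracOfCode_eq_coe, ENNReal.coe_lt_coe,
    div_lt_div_iff₀ (by positivity) (by positivity)]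
  norm_cast

theorem exists_fracOfCode_btwn {a b : ℝ≥0∞} (h : a < b) :
    ∃ p, a < fracOfCode p ∧ fracOfCode p < b := by
  obtain ⟨q, hq, haq, hqb⟩ := ENNReal.lt_iff_exists_rat_btwn.1 h
  have : fracOfCode (q.num.toNat, q.den - 1) = (Real.toNNReal q : ℝ≥0∞) := by
    rw [fracOfCode_eq_ofReal]
    congr 2
    have h1 : ((q.num.toNat : ℕ) : ℝ) = (q.num : ℝ) := by
      exact_mod_cast congrArg (Int.cast (R := ℝ)) (Int.toNat_of_nonneg (Rat.num_nonneg.2 hq))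
    have h2 : ((q.den - 1 : ℕ) : ℝ) + 1 = q.den := by
      exact_mod_cast Nat.sub_add_cancel q.pos
    rw [h1, h2]
    exact_mod_cast Rat.num_div_den q
  exact ⟨_, this ▸ haq, this ▸ hqb⟩

/-- A function with values in `[0, ∞]` is lower semicomputable if it is the supremum of a
computable sequence of functions with nonnegative rational values. -/
def IsLSC {α : Type*} [Primcodable α] (f : α → ℝ≥0∞) : Prop :=
  ∃ g : α × ℕ → ℕ × ℕ, Computable g ∧ ∀ x, f x = ⨆ s, fracOfCode (g (x, s))

namespace IsLSC

variable {α β : Type*} [Primcodable α] [Primcodable β]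

theorem of_eq {f g : α → ℝ≥0∞} (hf : IsLSC f) (h : ∀ x, f x = g x) : IsLSC g :=
  funext h ▸ hf

theorem of_computable {g : α → ℕ × ℕ} (hg : Computable g) : IsLSC fun x => fracOfCode (g x) :=
  ⟨fun y => g y.1, hg.comp Computable.fst, fun _ => iSup_const.symm⟩

theorem comp {f : β → ℝ≥0∞} (hf : IsLSC f) {h : α → β} (hh : Computable h) :
    IsLSC fun x => f (h x) := by
  obtain ⟨g, hg, hfg⟩ := hf
  exact ⟨fun y => g (h y.1, y.2), hg.comp ((hh.comp Computable.fst).pair Computable.snd),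
    fun x => hfg _⟩

theorem iSup_nat {f : α × ℕ → ℝ≥0∞} (hf : IsLSC f) : IsLSC fun x => ⨆ n, f (x, n) := by
  obtain ⟨g, hg, hfg⟩ := hf
  have hu := Computable.unpair.comp (Computable.snd (α := α) (β := ℕ))
  refine ⟨fun y => g ((y.1, y.2.unpair.1), y.2.unpair.2),
    hg.comp ((Computable.fst.pair (Computable.fst.comp hu)).pair (Computable.snd.comp hu)),
    fun x => ?_⟩
  simp only [hfg]
  refine le_antisymm (iSup₂_le fun n s => ?_) (iSup_le fun s => ?_)
  · exact le_iSup_of_le (Nat.pair n s) (by simp)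
  · exact le_iSup₂_of_le s.unpair.1 s.unpair.2 le_rfl

theorem option_elim {f : α × β → ℝ≥0∞} (hf : IsLSC f) {o : α → Option β} (ho : Computable o) :
    IsLSC fun x => (o x).elim 0 fun b => f (x, b) := by
  obtain ⟨g, hg, hfg⟩ := hf
  have hc : Computable fun z : (α × ℕ) × β => ((z.1.1, z.2), z.1.2) :=
    ((Computable.fst.comp Computable.fst).pair Computable.snd).pair
      (Computable.snd.comp Computable.fst)
  refine ⟨fun y => ((o y.1).map fun b => g ((y.1, b), y.2)).getD (0, 0),
    Computable.option_getD (Computable.option_map (ho.comp Computable.fst)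
      (Computable₂.mk (hg.comp hc))) (Computable.const (0, 0)), fun x => ?_⟩
  dsimp only
  cases o x <;> simp [hfg]

theorem iSup {f : α × β → ℝ≥0∞} (hf : IsLSC f) : IsLSC fun x => ⨆ b, f (x, b) := by
  have hc : Computable fun z : (α × ℕ) × β => (z.1.1, z.2) :=
    (Computable.fst.comp Computable.fst).pair Computable.snd
  refine ((hf.comp hc).option_elim (Computable.decode.comp Computable.snd)).iSup_nat.of_eq
    fun x => le_antisymm (iSup_le fun n => ?_) (iSup_le fun b => ?_)
  · cases h : decode (α := β) n with
    | none => simp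
    | some b => simpa using le_iSup (fun b => f (x, b)) b
  · exact le_iSup_of_le (encode b) (by simp)

theorem add {f g : α → ℝ≥0∞} (hf : IsLSC f) (hg : IsLSC g) : IsLSC fun x => f x + g x := by
  obtain ⟨a, ha, hfa⟩ := hf
  obtain ⟨b, hb, hgb⟩ := hg
  have h1 := ha.comp (Computable.fst (α := α × ℕ) (β := ℕ))
  have h2 := hb.comp ((Computable.fst.comp (Computable.fst (α := α × ℕ) (β := ℕ))).pair
    Computable.snd)
  have hadd : Computable fun z : (ℕ × ℕ) × (ℕ × ℕ) =>
      (z.1.1 * (z.2.2 + 1) + z.2.1 * (z.1.2 + 1), z.1.2 * z.2.2 + z.1.2 + z.2.2) := by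
    have a1 := Primrec.fst.comp (Primrec.fst (α := ℕ × ℕ) (β := ℕ × ℕ))
    have a2 := Primrec.snd.comp (Primrec.fst (α := ℕ × ℕ) (β := ℕ × ℕ))
    have b1 := Primrec.fst.comp (Primrec.snd (α := ℕ × ℕ) (β := ℕ × ℕ))
    have b2 := Primrec.snd.comp (Primrec.snd (α := ℕ × ℕ) (β := ℕ × ℕ))
    exact (Primrec.pair
      (Primrec.nat_add.comp (Primrec.nat_mul.comp a1 (Primrec.succ.comp b2))
        (Primrec.nat_mul.comp b1 (Primrec.succ.comp a2)))
      (Primrec.nat_add.comp (Primrec.nat_add.comp (Primrec.nat_mul.comp a2 b2) a2) b2)).to_comp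
  refine (of_computable (hadd.comp (h1.pair h2))).iSup_nat.iSup_nat.of_eq fun x => ?_
  simp only [hfa, hgb, ENNReal.iSup_add, ENNReal.add_iSup, fracOfCode_add]
  exact iSup_comm

theorem mul {f g : α → ℝ≥0∞} (hf : IsLSC f) (hg : IsLSC g) : IsLSC fun x => f x * g x := by
  obtain ⟨a, ha, hfa⟩ := hf
  obtain ⟨b, hb, hgb⟩ := hg
  have h1 := ha.comp (Computable.fst (α := α × ℕ) (β := ℕ))
  have h2 := hb.comp ((Computable.fst.comp (Computable.fst (α := α × ℕ) (β := ℕ))).pair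
    Computable.snd)
  have hmul : Computable fun z : (ℕ × ℕ) × (ℕ × ℕ) =>
      (z.1.1 * z.2.1, z.1.2 * z.2.2 + z.1.2 + z.2.2) := by
    have a1 := Primrec.fst.comp (Primrec.fst (α := ℕ × ℕ) (β := ℕ × ℕ))
    have a2 := Primrec.snd.comp (Primrec.fst (α := ℕ × ℕ) (β := ℕ × ℕ))
    have b1 := Primrec.fst.comp (Primrec.snd (α := ℕ × ℕ) (β := ℕ × ℕ))
    have b2 := Primrec.snd.comp (Primrec.snd (α := ℕ × ℕ) (β := ℕ × ℕ))
    exact (Primrec.pair (Primrec.nat_mul.comp a1 b1)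
      (Primrec.nat_add.comp (Primrec.nat_add.comp (Primrec.nat_mul.comp a2 b2) a2) b2)).to_comp
  refine (of_computable (hmul.comp (h1.pair h2))).iSup_nat.iSup_nat.of_eq fun x => ?_
  simp only [hfa, hgb, ENNReal.iSup_mul, ENNReal.mul_iSup, fracOfCode_mul]
  exact iSup_comm

theorem sum_range {f : α × ℕ → ℝ≥0∞} (hf : IsLSC f) {n : α → ℕ} (hn : Computable n) :
    IsLSC fun x => ∑ i ∈ Finset.range (n x), f (x, i) := by
  obtain ⟨g, hg, hfg⟩ := hf
  let t : ℕ → ℕ → ℕ := fun s i => ((Denumerable.ofNat (List ℕ) s)[i]?).getD 0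
  have ht : Computable₂ t := Computable₂.mk <| Computable.option_getD
    (Computable.list_getElem?.comp ((Computable.ofNat (List ℕ)).comp Computable.fst)
      Computable.snd) (Computable.const 0)
  let add : ℕ × ℕ → ℕ × ℕ → ℕ × ℕ := fun p q =>
    (p.1 * (q.2 + 1) + q.1 * (p.2 + 1), p.2 * q.2 + p.2 + q.2)
  have hadd : Computable₂ add := by
    have a1 := Primrec.fst.comp (Primrec.fst (α := ℕ × ℕ) (β := ℕ × ℕ))
    have a2 := Primrec.snd.comp (Primrec.fst (α := ℕ × ℕ) (β := ℕ × ℕ))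
    have b1 := Primrec.fst.comp (Primrec.snd (α := ℕ × ℕ) (β := ℕ × ℕ))
    have b2 := Primrec.snd.comp (Primrec.snd (α := ℕ × ℕ) (β := ℕ × ℕ))
    exact (Primrec.pair
      (Primrec.nat_add.comp (Primrec.nat_mul.comp a1 (Primrec.succ.comp b2))
        (Primrec.nat_mul.comp b1 (Primrec.succ.comp a2)))
      (Primrec.nat_add.comp (Primrec.nat_add.comp (Primrec.nat_mul.comp a2 b2) a2) b2)).to_comp
  let G : α × ℕ → ℕ → ℕ × ℕ := fun y m =>
    Nat.rec (0, 0) (fun i r => add r (g ((y.1, i), t y.2 i))) m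
  have hG : Computable fun y : α × ℕ => G y (n y.1) := by
    refine Computable.nat_rec (h := fun (y : α × ℕ) (z : ℕ × (ℕ × ℕ)) =>
      add z.2 (g ((y.1, z.1), t y.2 z.1))) (hn.comp Computable.fst) (Computable.const (0, 0)) ?_
    have hi := Computable.fst.comp (Computable.snd (α := α × ℕ) (β := ℕ × (ℕ × ℕ)))
    exact hadd.comp (Computable.snd.comp Computable.snd)
      (hg.comp (((Computable.fst.comp Computable.fst).pair hi).pair
        (ht.comp (Computable.snd.comp Computable.fst) hi)))
  have hGsum : ∀ y m, fracOfCode (G y m) =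
      ∑ i ∈ Finset.range m, fracOfCode (g ((y.1, i), t y.2 i)) := fun y m => by
    induction m with
    | zero => simp [G]
    | succ m ih => rw [Finset.sum_range_succ, ← ih, fracOfCode_add]
  refine (of_computable hG).iSup_nat.of_eq fun x => ?_
  simp only [hGsum, hfg]
  refine le_antisymm (iSup_le fun s => Finset.sum_le_sum fun i _ =>
    le_iSup (fun s => fracOfCode (g ((x, i), s))) _) ?_
  have key : ∀ m, (∑ i ∈ Finset.range m, ⨆ s, fracOfCode (g ((x, i), s))) ≤
      ⨆ l : List ℕ, ∑ i ∈ Finset.range m, fracOfCode (g ((x, i), l[i]?.getD 0)) := fun m => by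
    induction m with
    | zero => simp
    | succ m ih =>
      rw [Finset.sum_range_succ]
      refine (add_le_add_left ih _).trans ?_
      simp only [ENNReal.iSup_add, ENNReal.add_iSup]
      refine iSup₂_le fun s l => ?_
      refine le_iSup_of_le ((List.range m).map (fun i => l[i]?.getD 0) ++ [s]) ?_
      rw [Finset.sum_range_succ]
      refine add_le_add (Finset.sum_le_sum fun i hi => ?_) ?_
      · have hi := Finset.mem_range.1 hi
        simp [List.getElem?_append, hi]
      · simp
  exact (key _).trans (iSup_le fun l => le_iSup_of_le (encode l) (by simp [t]))

theorem tsum_nat {f : α × ℕ → ℝ≥0∞} (hf : IsLSC f) : IsLSC fun x => ∑' n, f (x, n) := by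
  have hc : Computable fun z : (α × ℕ) × ℕ => (z.1.1, z.2) :=
    (Computable.fst.comp Computable.fst).pair Computable.snd
  exact ((hf.comp hc).sum_range Computable.snd).iSup_nat.of_eq fun x =>
    (ENNReal.tsum_eq_iSup_nat (f := fun n => f (x, n))).symm

theorem list_sum {f : α × β → ℝ≥0∞} (hf : IsLSC f) {l : α → List β} (hl : Computable l) :
    IsLSC fun x => ((l x).map fun b => f (x, b)).sum := by
  have hc : Computable fun z : (α × ℕ) × β => (z.1.1, z.2) :=
    (Computable.fst.comp Computable.fst).pair Computable.snd
  refine (((hf.comp hc).option_elim (Computable.list_getElem?.comp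
    (hl.comp Computable.fst) Computable.snd)).sum_range
      (Computable.list_length.comp hl)).of_eq fun x => ?_
  change (∑ i ∈ Finset.range (l x).length, (l x)[i]?.elim 0 fun b => f (x, b)) = _
  generalize l x = m
  induction m with
  | nil => simp
  | cons b m ih => simp [Finset.sum_range_succ', ← ih, add_comm]

theorem sum [Fintype β] {f : α × β → ℝ≥0∞} (hf : IsLSC f) :
    IsLSC fun x => ∑ b, f (x, b) :=
  (hf.list_sum (Computable.const Finset.univ.toList)).of_eq fun x =>
    Finset.sum_map_toList _ fun b => f (x, b)

theorem indicator {p : α → Prop} [DecidablePred p] (hp : SigmaPred 1 p) :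
    IsLSC fun x => if p x then 1 else 0 := by
  classical
  obtain ⟨T, ⟨_, hT⟩, h⟩ := hp
  refine (of_computable (g := fun y => (bif decide (T y) then 0 else 1, 0))
    ((Computable.cond hT (Computable.const 0) (Computable.const 1)).pair
      (Computable.const 0))).iSup_nat.of_eq fun x => ?_
  by_cases hx : p x
  · obtain ⟨k, hk⟩ := (h x).1 hx
    rw [if_pos hx]
    refine le_antisymm (iSup_le fun s => ?_) (le_iSup_of_le k (by simp [hk, fracOfCode]))
    by_cases hs : T (x, s) <;> simp [hs, fracOfCode]
  · have := fun k => not_not.1 fun hk => hx ((h x).2 ⟨k, hk⟩)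
    simp [hx, this]

theorem sigmaPred_lt {f : α → ℝ≥0∞} (hf : IsLSC f) :
    SigmaPred 1 fun y : α × (ℕ × ℕ) => fracOfCode y.2 < f y.1 := by
  obtain ⟨g, hg, hfg⟩ := hf
  have hgc : Computable fun z : (α × (ℕ × ℕ)) × ℕ => g (z.1.1, z.2) :=
    hg.comp ((Computable.fst.comp Computable.fst).pair Computable.snd)
  have hq : Computable fun z : (α × (ℕ × ℕ)) × ℕ => z.1.2 := Computable.snd.comp Computable.fst
  have hlt : ComputablePred fun z : (α × (ℕ × ℕ)) × ℕ =>
      z.1.2.1 * ((g (z.1.1, z.2)).2 + 1) < (g (z.1.1, z.2)).1 * (z.1.2.2 + 1) :=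
    Primrec.nat_lt.computablePred_comp
      (Primrec.nat_mul.to_comp.comp (Computable.fst.comp hq)
        (Computable.succ.comp (Computable.snd.comp hgc)))
      (Primrec.nat_mul.to_comp.comp (Computable.fst.comp hgc)
        (Computable.succ.comp (Computable.snd.comp hq)))
  exact (SigmaPred.of_computablePred hlt).exists_nat.of_eq fun y => by
    simp only [hfg, lt_iSup_iff, fracOfCode_lt_iff]

theorem sigmaPred_unpair_lt {f : α → ℝ≥0∞} (hf : IsLSC f) :
    SigmaPred 1 fun y : α × ℕ => fracOfCode y.2.unpair < f y.1 := by
  have hc := (Computable.fst (α := α) (β := ℕ)).pair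
    (Computable.unpair.comp (Computable.snd (α := α) (β := ℕ)))
  have := hf.sigmaPred_lt.comp hc
  exact this

theorem sigmaPred_not_gt_and_lt {f g : α → ℝ≥0∞} (hf : IsLSC f) (hg : IsLSC g) :
    SigmaPred 2 fun x => ∃ k : ℕ, ¬ fracOfCode k.unpair < f x ∧ fracOfCode k.unpair < g x :=
  (hf.sigmaPred_unpair_lt.not.and hg.sigmaPred_unpair_lt.succ).exists_nat

theorem sigmaPred_le {f g : α → ℝ≥0∞} (hf : IsLSC f) (hg : IsLSC g) :
    SigmaPred 3 fun x => f x ≤ g x := by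
  refine (hg.sigmaPred_not_gt_and_lt hf).not.of_eq fun x =>
    ⟨fun hx => le_of_not_gt fun hlt => ?_, fun hle ⟨k, hk, hk'⟩ => hk (hk'.trans_le hle)⟩
  obtain ⟨p, hp, hp'⟩ := exists_fracOfCode_btwn hlt
  exact hx ⟨Nat.pair p.1 p.2, by simpa using hp.le, by simpa using hp'⟩

theorem sigmaPred_eq_zero_or_lt {f g : α → ℝ≥0∞} (hf : IsLSC f) (hg : IsLSC g) :
    SigmaPred 2 fun x => f x = 0 ∨ f x < g x := by
  refine ((hf.sigmaPred_lt.comp (Computable.id.pair (Computable.const (0, 0)))).not.or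
    (hf.sigmaPred_not_gt_and_lt hg)).of_eq fun x => or_congr (by simp) ?_
  refine ⟨fun ⟨k, hk, hk'⟩ => (not_lt.1 hk).trans_lt hk', fun hlt => ?_⟩
  obtain ⟨p, hp, hp'⟩ := exists_fracOfCode_btwn hlt
  exact ⟨Nat.pair p.1 p.2, by simpa using hp.le, by simpa using hp'⟩

end IsLSC

theorem fracOfCode_le_ofReal_of_ratOfCode_le {q : ℕ × ℕ × ℕ} {y : ℝ} (h : (ratOfCode q : ℝ) ≤ y) :
    fracOfCode (q.1 - q.2.1, q.2.2) ≤ ENNReal.ofReal y := by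
  rcases le_total q.1 q.2.1 with hq | hq
  · simp [Nat.sub_eq_zero_of_le hq]
  · rw [fracOfCode_eq_ofReal]
    refine ENNReal.ofReal_le_ofReal (le_trans (le_of_eq ?_) h)
    simp [ratOfCode, Nat.cast_sub hq]

theorem LowerSemicomputable.isLSC {α : Type*} [Primcodable α] {f : α → ℝ}
    (hf : LowerSemicomputable f) : IsLSC fun x => ENNReal.ofReal (f x) := by
  classical
  obtain ⟨S, hS, h⟩ := hf
  have hmem : ∀ x q, (ratOfCode q : ℝ) < f x ↔ ∃ j, S (encode (x, q)) [j] := fun x q => by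
    refine Iff.trans ?_ (h (encode (x, q)))
    refine ⟨fun hx => ⟨(x, q), hx, rfl⟩, fun ⟨z, hz, hzx⟩ => ?_⟩
    rw [encode_injective hzx] at hz
    exact hz
  let F : α × (ℕ × ℕ × ℕ) × ℕ → ℕ × ℕ := fun y =>
    bif decide (S (encode (y.1, y.2.1)) [y.2.2]) then (y.2.1.1 - y.2.1.2.1, y.2.1.2.2) else (0, 0)
  have hF : Computable F := by
    have hq : Computable fun y : α × (ℕ × ℕ × ℕ) × ℕ => y.2.1 := Computable.fst.comp Computable.snd
    have hq2 := Computable.snd.comp hq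
    have he : Computable fun y : α × (ℕ × ℕ × ℕ) × ℕ => (encode (y.1, y.2.1), [y.2.2]) :=
      (Computable.encode.comp (Computable.fst.pair hq)).pair
        (Computable.list_cons.comp (Computable.snd.comp Computable.snd) (Computable.const []))
    exact Computable.cond (hS.comp he).decide
      ((Primrec.nat_sub.to_comp.comp (Computable.fst.comp hq) (Computable.fst.comp hq2)).pair
        (Computable.snd.comp hq2)) (Computable.const (0, 0))
  have hF1 : ∀ {x q j}, S (encode (x, q)) [j] → F (x, q, j) = (q.1 - q.2.1, q.2.2) :=
    fun {x q j} hS => by simp only [F, hS, decide_true, cond_true]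
  have hF0 : ∀ {x q j}, ¬ S (encode (x, q)) [j] → F (x, q, j) = (0, 0) :=
    fun {x q j} hS => by simp only [F, hS, decide_false, cond_false]
  refine (IsLSC.of_computable hF).iSup.of_eq fun x =>
    le_antisymm (iSup_le fun y => ?_) (le_of_forall_lt fun c hc => ?_)
  · by_cases hy : S (encode (x, y.1)) [y.2]
    · rw [hF1 hy]
      exact fracOfCode_le_ofReal_of_ratOfCode_le ((hmem _ _).2 ⟨_, hy⟩).le
    · simp [hF0 hy]
  · obtain ⟨p, hcp, hp⟩ := exists_fracOfCode_btwn hc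
    have hp' : (ratOfCode (p.1, 0, p.2) : ℝ) < f x := by
      rw [fracOfCode_eq_ofReal, ENNReal.ofReal_lt_ofReal_iff_of_nonneg (by positivity)] at hp
      simpa [ratOfCode] using hp
    obtain ⟨j, hj⟩ := (hmem _ _).1 hp'
    exact hcp.trans_le (le_iSup_of_le ((p.1, 0, p.2), j) (by rw [hF1 hj]; simp))

theorem REPred.sigmaPred {α : Type*} [Primcodable α] {p : α → Prop} (hp : REPred p) :
    SigmaPred 1 p := by
  obtain ⟨c, hc⟩ := Nat.Partrec.Code.exists_code.1 hp
  refine (SigmaPred.of_computablePred (p := fun y : α × ℕ =>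
    (Nat.Partrec.Code.evaln y.2 c (encode y.1)).isSome = true) ?_).exists_nat.of_eq fun x => ?_
  · exact ComputablePred.computable_iff.2 ⟨_, (Primrec.option_isSome.comp
      (Nat.Partrec.Code.primrec_evaln.comp ((Primrec.snd.pair (Primrec.const c)).pair
        (Primrec.encode.comp Primrec.fst)))).to_comp, rfl⟩
  · have hx := congrFun hc (encode x)
    have hdom : ((c.eval (encode x)).Dom) ↔ p x := by
      rw [hx]
      simp [Part.assert]
    rw [← hdom, Part.dom_iff_mem]
    simp only [Nat.Partrec.Code.evaln_complete, Option.isSome_iff_exists, Option.mem_def]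
    exact exists_comm

/-! ### Values of policies -/

section Value

variable {A E : Type*} [Fintype E]

/-- The sum of `F` over the histories that arise from `h` by one step of the policy `π`. -/
noncomputable def policyStep (π : Policy A E) (F : Hist A E → ℝ≥0∞) (h : Hist A E) : ℝ≥0∞ :=
  ∑ e, F (h ++ [(π h, e)])

theorem policyStep_iterate_add (π : Policy A E) (k : ℕ) (F G : Hist A E → ℝ≥0∞) :
    (policyStep π)^[k] (F + G) = (policyStep π)^[k] F + (policyStep π)^[k] G := by
  induction k generalizing F G with
  | zero => rfl
  | succ k ih =>
    have : policyStep π (F + G) = policyStep π F + policyStep π G :=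
      funext fun h => Finset.sum_add_distrib
    simp only [Function.iterate_succ_apply, this, ih]

theorem policyStep_mono (π : Policy A E) : Monotone (policyStep π) :=
  fun _ _ hFG _ => Finset.sum_le_sum fun _ _ => hFG _

theorem policyStep_iterate_le {ν : Hist A E → ℝ≥0∞} (hν : ∀ h a, ∑ e, ν (h ++ [(a, e)]) ≤ ν h)
    (π : Policy A E) {F : Hist A E → ℝ≥0∞} {c : ℝ≥0∞} {k : ℕ} {h : Hist A E}
    (hF : ∀ h' : Hist A E, h'.length = h.length + k → F h' ≤ c * ν h') :
    (policyStep π)^[k] F h ≤ c * ν h := by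
  induction k generalizing h with
  | zero => exact hF h rfl
  | succ k ih =>
    rw [Function.iterate_succ_apply']
    calc policyStep π ((policyStep π)^[k] F) h ≤ ∑ e, c * ν (h ++ [(π h, e)]) :=
          Finset.sum_le_sum fun e _ => ih fun h' hh' => hF h' (by simp at hh'; omega)
      _ ≤ c * ν h := by
          rw [← Finset.mul_sum]
          gcongr
          exact hν h _

theorem sum_playOut (π : Policy A E) (F : Hist A E → ℝ≥0∞) (k : ℕ) (h : Hist A E) :
    ∑ es : Fin k → E, F (playOut π h (List.ofFn es)) = (policyStep π)^[k] F h := by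
  induction k generalizing h with
  | zero => simp [playOut]
  | succ k ih =>
    rw [Function.iterate_succ_apply', ← (Fin.consEquiv fun _ => E).sum_comp, Fintype.sum_prod_type]
    refine Finset.sum_congr rfl fun e _ => ?_
    rw [← ih]
    simp [List.ofFn_succ, playOut, Fin.consEquiv]

theorem playOut_concat {A E : Type*} (π : Policy A E) (h : Hist A E) (es : List E) (e : E) :
    playOut π h (es ++ [e]) = playOut π h es ++ [(π (playOut π h es), e)] := by
  induction es generalizing h with
  | nil => rfl
  | cons _ _ ih => exact ih _

theorem length_playOut {A E : Type*} (π : Policy A E) (h : Hist A E) (es : List E) :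
    (playOut π h es).length = h.length + es.length := by
  induction es generalizing h with
  | nil => rfl
  | cons _ _ ih =>
    rw [playOut, ih]
    simp
    omega

/-- The reward after the history `h`, weighted by its discount and its probability. -/
noncomputable def weightedReward (r : E → ℝ≥0∞) (γ : ℕ → ℝ≥0∞) (ν : Hist A E → ℝ≥0∞)
    (h : Hist A E) : ℝ≥0∞ :=
  γ h.length * (h.getLast?.elim 0 fun x => r x.2) * ν h

/-- The sum of all future weighted rewards after the history `h`. -/
noncomputable def totalReward (g : Hist A E → ℝ≥0∞) (π : Policy A E) (h : Hist A E) : ℝ≥0∞ :=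
  ∑' k, (policyStep π)^[k + 1] g h

/-- The optimal sum of all future weighted rewards after the history `h`. -/
noncomputable def optReward (g : Hist A E → ℝ≥0∞) (h : Hist A E) : ℝ≥0∞ :=
  ⨆ π : Policy A E, totalReward g π h

/-- The optimal sum of all future weighted rewards after the history `h` and the action `a`. -/
noncomputable def actionReward (g : Hist A E → ℝ≥0∞) (h : Hist A E) (a : A) : ℝ≥0∞ :=
  ∑ e, (g (h ++ [(a, e)]) + optReward g (h ++ [(a, e)]))

theorem totalReward_eq (g : Hist A E → ℝ≥0∞) (π : Policy A E) (h : Hist A E) :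
    totalReward g π h =
      ∑ e, (g (h ++ [(π h, e)]) + totalReward g π (h ++ [(π h, e)])) := by
  rw [totalReward, tsum_eq_zero_add' ENNReal.summable, Finset.sum_add_distrib]
  congr 1
  simp only [totalReward]
  rw [← Summable.tsum_finsetSum fun _ _ => ENNReal.summable]
  exact tsum_congr fun k => by rw [Function.iterate_succ_apply']; rfl

theorem totalReward_le_optReward (g : Hist A E → ℝ≥0∞) (π : Policy A E) (h : Hist A E) :
    totalReward g π h ≤ optReward g h := le_iSup (fun π => totalReward g π h) π

theorem exists_optReward_le_actionReward [Finite A] [Nonempty A] (g : Hist A E → ℝ≥0∞)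
    (h : Hist A E) : ∃ a, optReward g h ≤ actionReward g h a := by
  obtain ⟨a, ha⟩ := Finite.exists_max (actionReward g h)
  refine ⟨a, iSup_le fun π => le_trans ?_ (ha (π h))⟩
  rw [totalReward_eq]
  exact Finset.sum_le_sum fun e _ => by gcongr; exact totalReward_le_optReward g π _

theorem optReward_le_sum_range {g δ : Hist A E → ℝ≥0∞} {π : Policy A E}
    (hπ : ∀ h, optReward g h ≤ actionReward g h (π h) + δ h) (n : ℕ) (h : Hist A E) :
    optReward g h ≤ ∑ k ∈ Finset.range n, ((policyStep π)^[k + 1] g h + (policyStep π)^[k] δ h) +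
      (policyStep π)^[n] (optReward g) h := by
  induction n with
  | zero => simp
  | succ n ih =>
    refine ih.trans ?_
    rw [Finset.sum_range_succ, add_assoc]
    gcongr
    have hle : optReward g ≤ policyStep π g + policyStep π (optReward g) + δ := fun h =>
      (hπ h).trans_eq (by simp [actionReward, policyStep, Finset.sum_add_distrib])
    refine ((policyStep_mono π).iterate n hle h).trans_eq ?_
    rw [policyStep_iterate_add, policyStep_iterate_add]
    simp only [Pi.add_apply, Function.iterate_succ_apply]
    ring

/-- The discount normalization factor with values in `[0, ∞]`. -/
noncomputable def discountTail (γ : ℕ → ℝ≥0∞) (t : ℕ) : ℝ≥0∞ := ∑' i, γ (t + i)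

theorem discountTail_antitone (γ : ℕ → ℝ≥0∞) : Antitone (discountTail γ) := by
  refine antitone_nat_of_succ_le fun t => ?_
  rw [discountTail, discountTail, tsum_eq_zero_add' (f := fun i => γ (t + i)) ENNReal.summable]
  exact le_add_left (tsum_congr fun i => by congr 1; omega).le

section Bounds

variable {r : E → ℝ≥0∞} {γ : ℕ → ℝ≥0∞} {ν : Hist A E → ℝ≥0∞} (hr : ∀ e, r e ≤ 1)
  (hν : ∀ h a, ∑ e, ν (h ++ [(a, e)]) ≤ ν h)

include hr

omit [Fintype E] in
theorem weightedReward_le (h : Hist A E) : weightedReward r γ ν h ≤ γ h.length * ν h := by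
  unfold weightedReward
  gcongr
  refine mul_le_of_le_one_right' ?_
  cases h.getLast? with
  | none => simp
  | some x => exact hr _

include hν

theorem policyStep_iterate_weightedReward_le (π : Policy A E) (k : ℕ) (h : Hist A E) :
    (policyStep π)^[k] (weightedReward r γ ν) h ≤ γ (h.length + k) * ν h :=
  policyStep_iterate_le hν π fun h' hh' => hh' ▸ weightedReward_le hr h'

theorem totalReward_le (π : Policy A E) (h : Hist A E) :
    totalReward (weightedReward r γ ν) π h ≤ discountTail γ (h.length + 1) * ν h := by
  rw [discountTail, ← ENNReal.tsum_mul_right]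
  refine ENNReal.tsum_le_tsum fun k => ?_
  refine (policyStep_iterate_weightedReward_le hr hν π (k + 1) h).trans_eq ?_
  congr 2
  omega

theorem optReward_le (h : Hist A E) :
    optReward (weightedReward r γ ν) h ≤ discountTail γ (h.length + 1) * ν h :=
  iSup_le fun π => totalReward_le hr hν π h

theorem optReward_le_add (hγ : ∑' t, γ t ≠ ∞) (hν_top : ∀ h, ν h ≠ ∞) {δ : Hist A E → ℝ≥0∞}
    {π : Policy A E} (hπ : ∀ h, optReward (weightedReward r γ ν) h ≤
      actionReward (weightedReward r γ ν) h (π h) + δ h) (h : Hist A E) :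
    optReward (weightedReward r γ ν) h ≤
      totalReward (weightedReward r γ ν) π h + ∑' k, (policyStep π)^[k] δ h := by
  have hlim : Filter.Tendsto (fun n => discountTail γ (h.length + n + 1) * ν h) Filter.atTop
      (nhds 0) := by
    have h1 : Filter.Tendsto (fun n => discountTail γ n) Filter.atTop (nhds 0) := by
      simpa only [discountTail, add_comm] using ENNReal.tendsto_sum_nat_add γ hγ
    have h2 := h1.comp (Filter.tendsto_add_atTop_nat (h.length + 1))
    have h3 := ENNReal.Tendsto.mul_const (b := ν h) h2 (Or.inr (hν_top h))
    rw [zero_mul] at h3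
    exact h3.congr fun n => by simp only [Function.comp]; congr 2; omega
  refine ge_of_tendsto' (x := Filter.atTop)
    (by simpa using hlim.const_add (totalReward (weightedReward r γ ν) π h +
      ∑' k, (policyStep π)^[k] δ h)) fun n => ?_
  refine (optReward_le_sum_range hπ n h).trans ?_
  rw [Finset.sum_add_distrib]
  gcongr
  · exact ENNReal.sum_le_tsum _
  · exact ENNReal.sum_le_tsum _
  · exact policyStep_iterate_le hν π fun h' hh' => hh' ▸ optReward_le hr hν h'

omit hr in
theorem tsum_policyStep_iterate_le (π : Policy A E) (j : ℕ) (h : Hist A E) :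
    ∑' k, (policyStep π)^[k] (fun h => discountTail γ (h.length + 1) * ν h *
      2⁻¹ ^ (h.length + j + 1)) h ≤ 2⁻¹ ^ j * (discountTail γ (h.length + 1) * ν h) := by
  have hle : ∀ k, (policyStep π)^[k] (fun h => discountTail γ (h.length + 1) * ν h *
      2⁻¹ ^ (h.length + j + 1)) h ≤
        2⁻¹ ^ (k + 1) * (2⁻¹ ^ j * (discountTail γ (h.length + 1) * ν h)) := fun k => by
    rw [← mul_assoc, ← mul_assoc, ← pow_add]
    refine policyStep_iterate_le hν π fun h' hh' => ?_
    rw [mul_right_comm, mul_comm (discountTail γ _)]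
    gcongr ?_ * ?_ * _
    · exact pow_le_pow_right_of_le_one' (by simp) (by omega)
    · exact discountTail_antitone γ (by omega)
  refine (ENNReal.tsum_le_tsum hle).trans_eq ?_
  rw [ENNReal.tsum_mul_right, ENNReal.tsum_geometric_add_one]
  simp [ENNReal.inv_mul_cancel]

end Bounds

end Value

/-! ### Lower semicomputability of the optimal value -/

section Computability

variable {A E : Type*} [Fintype E] [Primcodable A] [Primcodable E]

/-- The policy that looks up its actions in a list. -/
def listPolicy (a₀ : A) (c : List A) : Policy A E := fun h => c.getD (encode h) a₀

/-- The list of the histories that arise from `h` by `k` steps of the policy with the list `c`. -/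
noncomputable def listLayer (a₀ : A) (c : List A) (h : Hist A E) (k : ℕ) : List (Hist A E) :=
  Nat.rec [h] (fun _ l => l.flatMap fun h' =>
    Finset.univ.toList.map fun e => h' ++ [(listPolicy a₀ c h', e)]) k

theorem primrec_listLayer (a₀ : A) :
    Primrec fun x : (List A × Hist A E) × ℕ => listLayer a₀ x.1.1 x.1.2 x.2 := by
  have hpol : Primrec₂ fun (c : List A) (h : Hist A E) => listPolicy a₀ c h :=
    (Primrec.list_getD a₀).comp₂ Primrec₂.left (Primrec.encode.comp₂ Primrec₂.right)
  have hsucc : Primrec₂ fun (c : List A) (h : Hist A E) =>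
      Finset.univ.toList.map fun e => h ++ [(listPolicy a₀ c h, e)] := by
    refine Primrec.list_map (Primrec.const _) (Primrec₂.mk ?_)
    exact Primrec.list_concat.comp (Primrec.snd.comp Primrec.fst)
      ((hpol.comp (Primrec.fst.comp Primrec.fst) (Primrec.snd.comp Primrec.fst)).pair Primrec.snd)
  refine Primrec.nat_rec' (f := Prod.snd)
    (h := fun (x : (List A × Hist A E) × ℕ) (y : ℕ × List (Hist A E)) => y.2.flatMap fun h' =>
      Finset.univ.toList.map fun e => h' ++ [(listPolicy a₀ x.1.1 h', e)]) Primrec.snd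
    (Primrec.list_cons.comp (Primrec.snd.comp Primrec.fst) (Primrec.const [])) ?_
  refine Primrec.list_flatMap (Primrec.snd.comp Primrec.snd) (Primrec₂.mk ?_)
  exact hsucc.comp (Primrec.fst.comp (Primrec.fst.comp (Primrec.fst.comp Primrec.fst))) Primrec.snd

theorem sum_listLayer (a₀ : A) (c : List A) (h : Hist A E) (k : ℕ) (F : Hist A E → ℝ≥0∞) :
    ((listLayer a₀ c h k).map F).sum = (policyStep (listPolicy a₀ c))^[k] F h := by
  induction k generalizing F with
  | zero => simp [listLayer]
  | succ k ih =>
    rw [Function.iterate_succ_apply, ← ih, listLayer]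
    change (((listLayer a₀ c h k).flatMap _).map F).sum = _
    induction listLayer a₀ c h k with
    | nil => rfl
    | cons h' l ih =>
      rw [List.flatMap_cons, List.map_append, List.sum_append, ih, List.map_cons, List.sum_cons,
        List.map_map]
      congr 1
      exact Finset.sum_map_toList _ _

theorem exists_policyStep_iterate_congr (π : Policy A E) (k : ℕ) (h : Hist A E) :
    ∃ M, ∀ π' : Policy A E, (∀ h', encode h' < M → π' h' = π h') → ∀ F,
      (policyStep π')^[k] F h = (policyStep π)^[k] F h := by
  induction k generalizing h with
  | zero => exact ⟨0, fun _ _ _ => rfl⟩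
  | succ k ih =>
    choose M hM using ih
    refine ⟨max (encode h + 1) (Finset.univ.sup fun e => M (h ++ [(π h, e)])), fun π' hπ' F => ?_⟩
    rw [Function.iterate_succ_apply', Function.iterate_succ_apply', policyStep, policyStep,
      hπ' h (by simp)]
    refine Finset.sum_congr rfl fun e _ => hM _ π' (fun h' hh' => hπ' h' ?_) F
    exact lt_max_of_lt_right (hh'.trans_le
      (Finset.le_sup (f := fun e => M (h ++ [(π h, e)])) (Finset.mem_univ e)))

omit [Fintype E] in
theorem exists_listPolicy_eq (a₀ : A) (π : Policy A E) (M : ℕ) :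
    ∃ c : List A, ∀ h' : Hist A E, encode h' < M → listPolicy a₀ c h' = π h' := by
  refine ⟨(List.range M).map fun i => (decode (α := Hist A E) i).elim a₀ π, fun h' hh' => ?_⟩
  rw [listPolicy, List.getD_eq_getElem?_getD, List.getElem?_map, List.getElem?_range hh']
  simp

theorem optReward_eq_iSup_list (a₀ : A) (g : Hist A E → ℝ≥0∞) (h : Hist A E) :
    optReward g h = ⨆ c : List A, ∑' k, ((listLayer a₀ c h (k + 1)).map g).sum := by
  simp only [sum_listLayer]
  refine le_antisymm (iSup_le fun π => ?_)
    (iSup_le fun c => totalReward_le_optReward g (listPolicy a₀ c) h)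
  rw [totalReward, ENNReal.tsum_eq_iSup_nat]
  refine iSup_le fun n => ?_
  choose M hM using fun k => exists_policyStep_iterate_congr π k h
  obtain ⟨c, hc⟩ := exists_listPolicy_eq a₀ π ((Finset.range n).sup fun k => M (k + 1))
  refine le_iSup_of_le c (le_trans (Finset.sum_le_sum fun k hk => ?_)
    (ENNReal.sum_le_tsum (Finset.range n)))
  refine (hM (k + 1) _ (fun h' hh' => hc h' (hh'.trans_le ?_)) g).ge
  exact Finset.le_sup (f := fun k => M (k + 1)) hk

theorem isLSC_optReward [Nonempty A] {g : ℕ × Hist A E → ℝ≥0∞} (hg : IsLSC g) :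
    IsLSC fun x : ℕ × Hist A E => optReward (fun h => g (x.1, h)) x.2 := by
  have a₀ := Classical.arbitrary A
  have hx : Computable fun z : ((ℕ × Hist A E) × List A) × ℕ => ((z.1.2, z.1.1.2), z.2 + 1) :=
    ((Computable.snd.comp Computable.fst).pair
      (Computable.snd.comp (Computable.fst.comp Computable.fst))).pair
        (Computable.succ.comp Computable.snd)
  have hc := (primrec_listLayer (E := E) a₀).to_comp.comp hx
  have hg' : IsLSC fun z : (((ℕ × Hist A E) × List A) × ℕ) × Hist A E => g (z.1.1.1.1, z.2) :=
    hg.comp ((Computable.fst.comp (Computable.fst.comp (Computable.fst.comp Computable.fst))).pair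
      Computable.snd)
  exact (hg'.list_sum hc).tsum_nat.iSup.of_eq fun x => 
    (optReward_eq_iSup_list a₀ (fun h => g (x.1, h)) x.2).symm

theorem isLSC_actionReward [Nonempty A] {g : ℕ × Hist A E → ℝ≥0∞} (hg : IsLSC g) :
    IsLSC fun x : (ℕ × Hist A E) × A => actionReward (fun h => g (x.1.1, h)) x.1.2 x.2 := by
  have hc : Computable fun z : ((ℕ × Hist A E) × A) × E => (z.1.1.1, z.1.1.2 ++ [(z.1.2, z.2)]) :=
    (Computable.fst.comp (Computable.fst.comp Computable.fst)).pair (Computable.list_concat.comp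
      (Computable.snd.comp (Computable.fst.comp Computable.fst))
      ((Computable.snd.comp Computable.fst).pair Computable.snd))
  exact ((hg.comp hc).add ((isLSC_optReward hg).comp hc)).sum

omit [Fintype E] in
theorem isLSC_weightedReward {r : E → ℝ≥0∞} {γ : ℕ × ℕ → ℝ≥0∞} {ν : Hist A E → ℝ≥0∞}
    (hr : IsLSC r) (hγ : IsLSC γ) (hν : IsLSC ν) :
    IsLSC fun x : ℕ × Hist A E => weightedReward r (fun t => γ (x.1, t)) ν x.2 := by
  have hlast : Computable fun x : ℕ × Hist A E => x.2.getLast? :=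
    ((Primrec.list_head?.comp (Primrec.list_reverse.comp Primrec.snd)).of_eq
      fun x => by simp).to_comp
  exact ((hγ.comp (Computable.fst.pair (Computable.list_length.comp Computable.snd))).mul
    ((hr.comp (Computable.snd.comp Computable.snd)).option_elim hlast)).mul
      (hν.comp Computable.snd)

theorem isLSC_discountTail {γ : ℕ × ℕ → ℝ≥0∞} (hγ : IsLSC γ) :
    IsLSC fun x : ℕ × ℕ => discountTail (fun t => γ (x.1, t)) x.2 :=
  (hγ.comp ((Computable.fst.comp Computable.fst).pair
    (Primrec.nat_add.to_comp.comp (Computable.snd.comp Computable.fst) Computable.snd))).tsum_nat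

theorem isLSC_inv_two_pow {α : Type*} [Primcodable α] {f : α → ℕ} (hf : Computable f) :
    IsLSC fun x => (2⁻¹ : ℝ≥0∞) ^ f x := by
  have hpow : Computable fun x => 2 ^ f x - 1 := by
    have hp : Primrec fun n : ℕ => Nat.rec (motive := fun _ => ℕ) 1 (fun _ y => 2 * y) n :=
      Primrec.nat_rec₁ 1 (Primrec₂.mk (Primrec.nat_double.comp Primrec.snd))
    refine (Primrec.nat_sub.to_comp.comp (hp.to_comp.comp hf) (Computable.const 1)).of_eq
      fun x => ?_
    congr 1
    induction f x with
    | zero => rfl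
    | succ n ih => simp only [pow_succ, ← ih, mul_comm]
  refine (IsLSC.of_computable ((Computable.const 1).pair hpow)).of_eq fun x => ?_
  have : ((2 ^ f x - 1 : ℕ) : ℝ≥0∞) + 1 = 2 ^ f x := by
    exact_mod_cast Nat.sub_add_cancel Nat.one_le_two_pow
  rw [fracOfCode, this, ← ENNReal.inv_pow]
  simp

end Computability

/-! ### Optimal and `ε`-optimal policies -/

section Policies

variable {A E : Type*} [Fintype E]

/-- The weighted reward after a history for real-valued data. -/
noncomputable def realReward (r : E → ℝ) (γ : ℕ → ℝ) (ν : Hist A E → ℝ) : Hist A E → ℝ≥0∞ :=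
  weightedReward (fun e => ENNReal.ofReal (r e)) (fun t => ENNReal.ofReal (γ t))
    fun h => ENNReal.ofReal (ν h)

section RealValues

variable {r : E → ℝ} {γ : ℕ → ℝ} {ν : Hist A E → ℝ} (hr : ∀ e, 0 ≤ r e ∧ r e ≤ 1)
  (hγ : ∀ t, 0 ≤ γ t) (hγs : Summable γ) (hν : ∀ h, 0 ≤ ν h)
  (hν_sum : ∀ h a, ∑ e, ν (h ++ [(a, e)]) ≤ ν h)

include hγ in
theorem discountNorm_nonneg (t : ℕ) : 0 ≤ discountNorm γ t := tsum_nonneg fun _ => hγ _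

include hγ hγs in
theorem tsum_ofReal_discount_ne_top : ∑' t, ENNReal.ofReal (γ t) ≠ ∞ := by
  rw [← ENNReal.ofReal_tsum_of_nonneg hγ hγs]
  exact ENNReal.ofReal_ne_top

include hγ hγs in
theorem discountTail_ofReal (t : ℕ) :
    discountTail (fun t => ENNReal.ofReal (γ t)) t = ENNReal.ofReal (discountNorm γ t) := by
  rw [discountTail, discountNorm, ENNReal.ofReal_tsum_of_nonneg (fun i => hγ _)]
  exact hγs.comp_injective (add_right_injective t)

include hν hν_sum in
theorem sum_ofReal_le (h : Hist A E) (a : A) :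
    ∑ e, ENNReal.ofReal (ν (h ++ [(a, e)])) ≤ ENNReal.ofReal (ν h) := by
  rw [← ENNReal.ofReal_sum_of_nonneg fun e _ => hν _]
  exact ENNReal.ofReal_le_ofReal (hν_sum h a)

include hr in
omit [Fintype E] in
theorem ofReal_reward_le_one (e : E) : ENNReal.ofReal (r e) ≤ 1 :=
  ENNReal.ofReal_le_one.2 (hr e).2

include hr hν hν_sum

theorem policyStep_iterate_realReward_ne_top (π : Policy A E) (k : ℕ) (h : Hist A E) :
    (policyStep π)^[k] (realReward r γ ν) h ≠ ∞ :=
  ((policyStep_iterate_weightedReward_le (ofReal_reward_le_one hr) (sum_ofReal_le hν hν_sum)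
    π k h).trans_lt (ENNReal.mul_lt_top ENNReal.ofReal_lt_top ENNReal.ofReal_lt_top)).ne

include hγ

theorem toReal_policyStep_iterate (π : Policy A E) (k : ℕ) (h : Hist A E) :
    ((policyStep π)^[k + 1] (realReward r γ ν) h).toReal =
      ∑ es : Fin (k + 1) → E, γ (h.length + 1 + k) * r (es (Fin.last k)) *
        ν (playOut π h (List.ofFn es)) := by
  have hfin := policyStep_iterate_realReward_ne_top hr hν hν_sum (γ := γ) π (k + 1) h
  rw [← sum_playOut] at hfin ⊢
  rw [ENNReal.toReal_sum fun es _ => (ENNReal.sum_ne_top.1 hfin) es (Finset.mem_univ es)]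
  refine Finset.sum_congr rfl fun es _ => ?_
  have hlast : (playOut π h (List.ofFn es)).getLast?.elim 0
      (fun x => ENNReal.ofReal (r x.2)) = ENNReal.ofReal (r (es (Fin.last k))) := by
    rw [List.ofFn_succ', List.concat_eq_append, playOut_concat]
    simp
  rw [realReward, weightedReward, hlast, length_playOut, List.length_ofFn, ENNReal.toReal_mul,
    ENNReal.toReal_mul, ENNReal.toReal_ofReal (hγ _), ENNReal.toReal_ofReal (hr _).1,
    ENNReal.toReal_ofReal (hν _)]
  congr 3
  omega

theorem valueW_eq (π : Policy A E) (h : Hist A E) :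
    valueW r γ ν π h = (totalReward (realReward r γ ν) π h).toReal /
      (discountNorm γ (h.length + 1) * ν h) := by
  rw [valueW]
  split_ifs with h0
  · simp [h0]
  · simp only [← mul_div_assoc, ← Finset.sum_div, tsum_div_const]
    rw [totalReward, ENNReal.tsum_toReal_eq
      fun k => policyStep_iterate_realReward_ne_top hr hν hν_sum π (k + 1) h]
    simp only [toReal_policyStep_iterate hr hγ hν hν_sum]
    rw [one_div, inv_mul_eq_div, div_div]

include hγs

theorem optReward_realReward_le (h : Hist A E) : optReward (realReward r γ ν) h ≤
    ENNReal.ofReal (discountNorm γ (h.length + 1) * ν h) := by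
  rw [ENNReal.ofReal_mul (discountNorm_nonneg hγ _), ← discountTail_ofReal hγ hγs]
  exact optReward_le (ofReal_reward_le_one hr) (sum_ofReal_le hν hν_sum) h

theorem valueW_le_of_optReward_le {π : Policy A E} {h : Hist A E} {ε : ℝ} (hε : 0 ≤ ε)
    (hπ : optReward (realReward r γ ν) h ≤ totalReward (realReward r γ ν) π h +
      ENNReal.ofReal (ε * (discountNorm γ (h.length + 1) * ν h))) (π' : Policy A E) :
    valueW r γ ν π' h ≤ valueW r γ ν π h + ε := by
  have hB : 0 ≤ discountNorm γ (h.length + 1) * ν h :=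
    mul_nonneg (discountNorm_nonneg hγ _) (hν h)
  have hfin : totalReward (realReward r γ ν) π h ≠ ∞ :=
    ((totalReward_le_optReward _ π h).trans_lt
      ((optReward_realReward_le hr hγ hγs hν hν_sum h).trans_lt ENNReal.ofReal_lt_top)).ne
  rw [valueW_eq hr hγ hν hν_sum, valueW_eq hr hγ hν hν_sum]
  rcases hB.eq_or_lt with h0 | h0
  · simp [← h0, hε]
  · rw [div_le_iff₀ h0, add_mul, div_mul_cancel₀ _ h0.ne']
    have := ENNReal.toReal_mono (ENNReal.add_ne_top.2 ⟨hfin, ENNReal.ofReal_ne_top⟩)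
      ((totalReward_le_optReward _ π' h).trans hπ)
    rwa [ENNReal.toReal_add hfin ENNReal.ofReal_ne_top,
      ENNReal.toReal_ofReal (mul_nonneg hε hB)] at this

theorem isOptimal_of_optReward_le {π : Policy A E} (hπ : ∀ h, optReward (realReward r γ ν) h ≤
    actionReward (realReward r γ ν) h (π h)) : IsOptimal r γ ν π := by
  intro h
  have hle : optReward (realReward r γ ν) h ≤ totalReward (realReward r γ ν) π h := by
    have := optReward_le_add (ofReal_reward_le_one hr) (sum_ofReal_le hν hν_sum)
      (tsum_ofReal_discount_ne_top hγ hγs) (fun h => ENNReal.ofReal_ne_top) (δ := 0) (π := π)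
      (fun h => by simpa [realReward] using hπ h) h
    have h0 : ∀ k, (policyStep π)^[k] 0 h = 0 := fun k =>
      nonpos_iff_eq_zero.1 ((policyStep_iterate_le (sum_ofReal_le hν hν_sum) π (c := 0)
        (by simp)).trans_eq (zero_mul _))
    simpa [h0, realReward] using this
  have hmax := valueW_le_of_optReward_le hr hγ hγs hν hν_sum le_rfl (by simpa using hle)
  simp only [add_zero] at hmax
  have : Nonempty (Policy A E) := ⟨π⟩
  exact le_antisymm (le_ciSup ⟨_, Set.forall_mem_range.2 hmax⟩ π) (ciSup_le hmax)

theorem isEpsOptimal_of_optReward_le {π : Policy A E} {j : ℕ} {ε : ℝ} (hε : 2⁻¹ ^ j < ε)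
    (hπ : ∀ h, optReward (realReward r γ ν) h ≤ actionReward (realReward r γ ν) h (π h) +
      discountTail (fun t => ENNReal.ofReal (γ t)) (h.length + 1) * ENNReal.ofReal (ν h) *
        2⁻¹ ^ (h.length + j + 1)) : IsEpsOptimal r γ ν ε π := by
  intro h
  have hle := optReward_le_add (ofReal_reward_le_one hr) (sum_ofReal_le hν hν_sum)
    (tsum_ofReal_discount_ne_top hγ hγs) (fun h => ENNReal.ofReal_ne_top) hπ h
  have hle' := hle.trans (add_le_add_right
    (tsum_policyStep_iterate_le (sum_ofReal_le hν hν_sum) π j h) _)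
  have h2 : (2⁻¹ : ℝ≥0∞) ^ j = ENNReal.ofReal (2⁻¹ ^ j) := by
    rw [ENNReal.ofReal_pow (by positivity), ENNReal.ofReal_inv_of_pos two_pos]
    simp
  rw [discountTail_ofReal hγ hγs, h2, ← ENNReal.ofReal_mul (discountNorm_nonneg hγ _),
    ← ENNReal.ofReal_mul (by positivity)] at hle'
  have hmax := valueW_le_of_optReward_le hr hγ hγs hν hν_sum (by positivity) hle'
  have : Nonempty (Policy A E) := ⟨π⟩
  have : optValueW r γ ν h ≤ valueW r γ ν π h + 2⁻¹ ^ j := ciSup_le hmax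
  linarith

end RealValues

variable [Finite A] [Nonempty A] [Primcodable A] [Primcodable E]

omit [Fintype E] [Finite A] [Nonempty A] in
theorem deltaPred_policyFamilyGraph {n : ℕ} {f : ℕ × Hist A E → A}
    (hf : DeltaPred n fun y : (ℕ × Hist A E) × A => f y.1 = y.2) :
    DeltaPred n (policyFamilyGraph fun m h => f (m, h)) :=
  hf.comp (f := fun x : ℕ × Hist A E × A => ((x.1, x.2.1), x.2.2))
    ((Computable.fst.pair (Computable.fst.comp Computable.snd)).pair
      (Computable.snd.comp Computable.snd))

variable {r : E → ℝ} (hr : ∀ e, 0 ≤ r e ∧ r e ≤ 1) (hr_lsc : LowerSemicomputable r)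
  {γ : ℕ → ℕ → ℝ} (hγ : ∀ m t, 0 ≤ γ m t) (hγs : ∀ m, Summable (γ m))
  (hγ_lsc : IsLSC fun x : ℕ × ℕ => ENNReal.ofReal (γ x.1 x.2))
  {ν : Hist A E → ℝ} (hν : ∀ h, 0 ≤ ν h) (hν_sum : ∀ h a, ∑ e, ν (h ++ [(a, e)]) ≤ ν h)
  (hν_lsc : IsLSC fun h => ENNReal.ofReal (ν h))

include hr_lsc hγ_lsc hν_lsc in
omit [Fintype E] [Finite A] [Nonempty A] in
theorem isLSC_realReward : IsLSC fun x : ℕ × Hist A E => realReward r (γ x.1) ν x.2 :=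
  isLSC_weightedReward hr_lsc.isLSC hγ_lsc hν_lsc

include hr hr_lsc hγ hγs hγ_lsc hν hν_sum hν_lsc

theorem exists_optimal_policies : ∃ π : ℕ → Policy A E,
    (∀ m, IsOptimal r (γ m) ν (π m)) ∧ DeltaPred 3 (policyFamilyGraph π) := by
  have hg := isLSC_realReward hr_lsc hγ_lsc hν_lsc
  obtain ⟨f, hf, hfd⟩ := (((isLSC_optReward hg).comp Computable.fst).sigmaPred_le
    (isLSC_actionReward hg)).exists_choice fun x =>
      exists_optReward_le_actionReward (realReward r (γ x.1) ν) x.2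
  exact ⟨fun m h => f (m, h), fun m => isOptimal_of_optReward_le hr (hγ m) (hγs m) hν hν_sum
    fun h => hf (m, h), deltaPred_policyFamilyGraph hfd⟩

theorem exists_epsOptimal_policies {ε : ℝ} (hε : 0 < ε) : ∃ π : ℕ → Policy A E,
    (∀ m, IsEpsOptimal r (γ m) ν ε (π m)) ∧ DeltaPred 2 (policyFamilyGraph π) := by
  obtain ⟨j, hj⟩ := exists_pow_lt_of_lt_one hε (by norm_num : (2⁻¹ : ℝ) < 1)
  have hg := isLSC_realReward hr_lsc hγ_lsc hν_lsc
  let B : (ℕ × Hist A E) × A → ℝ≥0∞ := fun x =>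
    discountTail (fun t => ENNReal.ofReal (γ x.1.1 t)) (x.1.2.length + 1) *
      ENNReal.ofReal (ν x.1.2) * 2⁻¹ ^ (x.1.2.length + j + 1)
  have hB : IsLSC B := by
    have hm : Computable fun x : (ℕ × Hist A E) × A => x.1.1 :=
      Computable.fst.comp Computable.fst
    have hh : Computable fun x : (ℕ × Hist A E) × A => x.1.2 :=
      Computable.snd.comp Computable.fst
    have hl := Computable.list_length.comp hh
    exact (((isLSC_discountTail hγ_lsc).comp (hm.pair (Computable.succ.comp hl))).mul
      (hν_lsc.comp hh)).mul (isLSC_inv_two_pow (Computable.succ.comp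
        (Primrec.nat_add.to_comp.comp hl (Computable.const j))))
  have htot : ∀ x : ℕ × Hist A E, ∃ a, optReward (realReward r (γ x.1) ν) x.2 = 0 ∨
      optReward (realReward r (γ x.1) ν) x.2 <
        actionReward (realReward r (γ x.1) ν) x.2 a + B (x, a) := fun x => by
    obtain ⟨a, ha⟩ := exists_optReward_le_actionReward (realReward r (γ x.1) ν) x.2
    refine ⟨a, or_iff_not_imp_left.2 fun hpos => ?_⟩
    have hVB := optReward_le (ofReal_reward_le_one hr) (sum_ofReal_le hν hν_sum)
      (γ := fun t => ENNReal.ofReal (γ x.1 t)) x.2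
    have hBpos : B (x, a) ≠ 0 :=
      mul_ne_zero ((pos_iff_ne_zero.2 hpos).trans_le hVB).ne' (by simp)
    have hfin : optReward (realReward r (γ x.1) ν) x.2 ≠ ∞ :=
      ((optReward_realReward_le hr (hγ x.1) (hγs x.1) hν hν_sum x.2).trans_lt
        ENNReal.ofReal_lt_top).ne
    exact (ENNReal.lt_add_right hfin hBpos).trans_le (by gcongr)
  obtain ⟨f, hf, hfd⟩ := (((isLSC_optReward hg).comp Computable.fst).sigmaPred_eq_zero_or_lt
    ((isLSC_actionReward hg).add hB)).exists_choice htot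
  refine ⟨fun m h => f (m, h), fun m => isEpsOptimal_of_optReward_le hr (hγ m) (hγs m) hν hν_sum hj
    fun h => ?_, deltaPred_policyFamilyGraph hfd⟩
  rcases hf (m, h) with h0 | hlt
  · exact le_of_eq_of_le h0 zero_le
  · exact hlt.le

end Policies

/-! ### The universal mixture -/

theorem IsLSC.lowerSemicomputable {α : Type*} [Primcodable α] {f : α → ℝ} (hf : ∀ x, 0 ≤ f x)
    (h : IsLSC fun x => ENNReal.ofReal (f x)) : LowerSemicomputable f := by
  refine SigmaPred.isSigmaSet_codeSet ?_
  have hc : Computable fun y : α × (ℕ × ℕ × ℕ) => (y.1, (y.2.1 - y.2.2.1, y.2.2.2)) := by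
    refine Computable.fst.pair (Primrec.to_comp ?_)
    have h2 := Primrec.snd (α := α) (β := ℕ × ℕ × ℕ)
    exact (Primrec.nat_sub.comp (Primrec.fst.comp h2)
      (Primrec.fst.comp (Primrec.snd.comp h2))).pair (Primrec.snd.comp (Primrec.snd.comp h2))
  have hlt : ComputablePred fun y : α × (ℕ × ℕ × ℕ) => y.2.1 < y.2.2.1 :=
    Primrec.nat_lt.computablePred_comp (Computable.fst.comp Computable.snd)
      (Computable.fst.comp (Computable.snd.comp Computable.snd))
  refine ((SigmaPred.of_computablePred hlt).or (h.sigmaPred_lt.comp hc)).of_eq ?_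
  rintro ⟨x, a, b, c⟩
  rcases lt_or_ge a b with hab | hab
  · refine iff_of_true (Or.inl hab) (lt_of_lt_of_le ?_ (hf x))
    have : ((a : ℝ) - b) < 0 := sub_neg.2 (Nat.cast_lt.2 hab)
    simpa [ratOfCode] using div_neg_of_neg_of_pos this (by positivity : (0 : ℝ) < c + 1)
  · rw [or_iff_right (not_lt.2 hab), fracOfCode_eq_ofReal,
      ENNReal.ofReal_lt_ofReal_iff_of_nonneg (by positivity)]
    simp [ratOfCode, Nat.cast_sub hab]

/-- The list of all bit strings of length `n`. -/
def bitStrings (n : ℕ) : List (List Bool) :=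
  Nat.rec [[]] (fun _ l => l.flatMap fun p => [false :: p, true :: p]) n

theorem primrec_bitStrings : Primrec bitStrings := by
  refine Primrec.nat_rec₁ _ (Primrec₂.mk (Primrec.list_flatMap Primrec.snd (Primrec₂.mk ?_)))
  exact Primrec.list_cons.comp (Primrec.list_cons.comp (Primrec.const _) Primrec.snd)
    (Primrec.list_cons.comp (Primrec.list_cons.comp (Primrec.const _) Primrec.snd)
      (Primrec.const []))

theorem sum_bitStrings (n : ℕ) (F : List Bool → ℝ≥0∞) :
    ((bitStrings n).map F).sum = ∑ p : Fin n → Bool, F (List.ofFn p) := by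
  induction n generalizing F with
  | zero => simp [bitStrings]
  | succ n ih =>
    have h1 : ∀ l : List (List Bool),
        ((l.flatMap fun p => [false :: p, true :: p]).map F).sum =
          (l.map fun p => F (true :: p) + F (false :: p)).sum := fun l => by
      induction l with
      | nil => rfl
      | cons p l ih => simp [ih, add_assoc, add_comm]
    change (((bitStrings n).flatMap _).map F).sum = _
    rw [h1, ih, ← (Fin.consEquiv fun _ => Bool).sum_comp, Fintype.sum_prod_type_right]
    refine Finset.sum_congr rfl fun p _ => ?_
    simp [List.ofFn_succ, Fin.consEquiv]

section Semimeasure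

variable {A E : Type*} [Primcodable A] [Primcodable E]

namespace MonotoneMachine

variable (T : MonotoneMachine A E)

open Classical in
/-- The fraction of the inputs of length `n` on which `T` produces `h`. -/
noncomputable def outputFraction (n : ℕ) (h : Hist A E) : ℝ≥0∞ :=
  ∑ p : Fin n → Bool, (if T.Produces (List.ofFn p) h then 1 else 0) * 2⁻¹ ^ n

theorem ofReal_card_div (n : ℕ) (h : Hist A E) :
    ENNReal.ofReal ((Nat.card {p : Fin n → Bool // T.Produces (List.ofFn p) h} : ℝ) / 2 ^ n) =
      T.outputFraction n h := by
  classical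
  rw [outputFraction, ← Finset.sum_mul, Finset.sum_boole, Nat.card_eq_fintype_card,
    Fintype.card_subtype, ENNReal.ofReal_div_of_pos (by positivity), ENNReal.ofReal_natCast,
    ENNReal.ofReal_pow two_pos.le, div_eq_mul_inv, ENNReal.inv_pow]
  simp

theorem outputFraction_mono (h : Hist A E) : Monotone fun n => T.outputFraction n h := by
  classical
  refine monotone_nat_of_le_succ fun n => ?_
  rw [outputFraction, outputFraction, ← (Fin.snocEquiv fun _ => Bool).sum_comp,
    Fintype.sum_prod_type_right]
  refine Finset.sum_le_sum fun p _ => ?_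
  by_cases hp : T.Produces (List.ofFn p) h
  · have : ∀ b : Bool, T.Produces (List.ofFn (Fin.snocEquiv (fun _ => Bool) (b, p))) h :=
      fun b => T.mono _ _ _ (by rw [List.ofFn_succ']; simp [Fin.snocEquiv]) hp
    simp only [this, hp, if_true, one_mul, Finset.sum_const, Finset.card_univ, Fintype.card_bool,
      nsmul_eq_mul, pow_succ]
    rw [mul_left_comm, Nat.cast_ofNat, ENNReal.mul_inv_cancel two_ne_zero ENNReal.ofNat_ne_top,
      mul_one]
  · simp [hp]

theorem sum_outputFraction_le [Fintype E] (n : ℕ) (h : Hist A E) (a : A) :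
    ∑ e, T.outputFraction n (h ++ [(a, e)]) ≤ T.outputFraction n h := by
  classical
  simp only [outputFraction]
  rw [Finset.sum_comm]
  refine Finset.sum_le_sum fun p _ => ?_
  rw [← Finset.sum_mul]
  gcongr
  by_cases hex : ∃ e, T.Produces (List.ofFn p) (h ++ [(a, e)])
  · obtain ⟨e, he⟩ := hex
    rw [if_pos (T.chronological _ _ _ he), Finset.sum_eq_single e
      (fun e' _ hne => if_neg fun he' => hne (T.functional _ _ _ _ _ he' he)) (by simp)]
    split_ifs <;> simp
  · rw [Finset.sum_eq_zero fun e _ => if_neg (not_exists.1 hex e)]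
    exact zero_le

theorem outputFraction_le_one (n : ℕ) (h : Hist A E) : T.outputFraction n h ≤ 1 := by
  classical
  calc T.outputFraction n h ≤ ∑ _p : Fin n → Bool, 2⁻¹ ^ n :=
        Finset.sum_le_sum fun p _ => mul_le_of_le_one_left' (by split_ifs <;> simp)
    _ = 1 := by
      simp [← ENNReal.inv_pow, ENNReal.mul_inv_cancel]

theorem ofReal_semimeasure (h : Hist A E) :
    ENNReal.ofReal (T.semimeasure h) = ⨆ n, T.outputFraction n h := by
  have hfin : ∀ n, T.outputFraction n h ≠ ∞ := fun n =>
    ((T.outputFraction_le_one n h).trans_lt ENNReal.one_lt_top).ne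
  have hsup : ⨆ n, T.outputFraction n h ≠ ∞ :=
    ((iSup_le fun n => T.outputFraction_le_one n h).trans_lt ENNReal.one_lt_top).ne
  rw [← ENNReal.ofReal_toReal hsup, ENNReal.toReal_iSup hfin, semimeasure]
  congr 2
  funext n
  rw [← ofReal_card_div, ENNReal.toReal_ofReal (by positivity)]

theorem semimeasure_nonneg (h : Hist A E) : 0 ≤ T.semimeasure h :=
  Real.iSup_nonneg fun n => by positivity

theorem ofReal_semimeasure_le_one (h : Hist A E) : ENNReal.ofReal (T.semimeasure h) ≤ 1 :=
  (T.ofReal_semimeasure h).trans_le (iSup_le fun n => T.outputFraction_le_one n h)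

theorem sum_ofReal_semimeasure_le [Fintype E] (h : Hist A E) (a : A) :
    ∑ e, ENNReal.ofReal (T.semimeasure (h ++ [(a, e)])) ≤ ENNReal.ofReal (T.semimeasure h) := by
  simp only [ofReal_semimeasure]
  rw [ENNReal.finsetSum_iSup_of_monotone fun e => T.outputFraction_mono _]
  exact iSup_mono fun n => T.sum_outputFraction_le n h a

end MonotoneMachine

theorem isLSC_semimeasure {T : ℕ → MonotoneMachine A E}
    (hT : REPred fun x : ℕ × List Bool × Hist A E => (T x.1).Produces x.2.1 x.2.2) :
    IsLSC fun x : ℕ × Hist A E => ENNReal.ofReal ((T x.1).semimeasure x.2) := by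
  classical
  have hc : Computable fun z : ((ℕ × Hist A E) × ℕ) × List Bool => (z.1.1.1, z.2, z.1.1.2) :=
    (Computable.fst.comp (Computable.fst.comp Computable.fst)).pair (Computable.snd.pair
      (Computable.snd.comp (Computable.fst.comp Computable.fst)))
  have h1 := IsLSC.indicator (hT.sigmaPred.comp hc)
  have h2 := isLSC_inv_two_pow (Computable.snd.comp
    (Computable.fst (α := (ℕ × Hist A E) × ℕ) (β := List Bool)))
  refine ((h1.mul h2).list_sum (primrec_bitStrings.to_comp.comp Computable.snd)).iSup_nat.of_eq
    fun x => ?_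
  rw [MonotoneMachine.ofReal_semimeasure]
  refine iSup_congr fun n => ?_
  rw [sum_bitStrings]
  rfl

theorem sum_le_of_sum_ofReal_le {A E : Type*} [Fintype E] {ν : Hist A E → ℝ} (hν : ∀ h, 0 ≤ ν h)
    {h : Hist A E} {a : A}
    (hs : ∑ e, ENNReal.ofReal (ν (h ++ [(a, e)])) ≤ ENNReal.ofReal (ν h)) :
    ∑ e, ν (h ++ [(a, e)]) ≤ ν h := by
  rwa [← ENNReal.ofReal_sum_of_nonneg fun e _ => hν _, ENNReal.ofReal_le_ofReal_iff (hν h)] at hs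

theorem MonotoneMachine.isLSCCCS_semimeasure [Fintype E] (T : MonotoneMachine A E) :
    IsLSCCCS T.semimeasure where
  nonneg := T.semimeasure_nonneg
  nil_le := ENNReal.ofReal_le_one.1 (T.ofReal_semimeasure_le_one [])
  sum_le h a := sum_le_of_sum_ofReal_le T.semimeasure_nonneg (T.sum_ofReal_semimeasure_le h a)
  lsc := by
    have hT : REPred fun x : ℕ × List Bool × Hist A E => T.Produces x.2.1 x.2.2 :=
      Partrec.comp T.re Computable.snd
    have hc : Computable fun h : Hist A E => (0, h) := (Computable.const 0).pair Computable.id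
    have h := (isLSC_semimeasure (T := fun _ => T) hT).comp hc
    exact IsLSC.lowerSemicomputable T.semimeasure_nonneg h

namespace UniversalMachine

variable (U : UniversalMachine A E)

theorem code_injective : Function.Injective U.code := fun i j hij =>
  U.code_prefixFree i j (hij ▸ List.prefix_rfl)

theorem code_ne_nil (i : ℕ) : U.code i ≠ [] := fun hi =>
  absurd ((U.code_prefixFree i 0 (hi ▸ List.nil_prefix)).symm.trans
    (U.code_prefixFree i 1 (hi ▸ List.nil_prefix))) zero_ne_one

theorem uniquelyDecodable_range_code :
    InformationTheory.UniquelyDecodable (Set.range U.code) := by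
  intro L₁
  induction L₁ with
  | nil =>
    intro L₂ _ h₂ h
    cases L₂ with
    | nil => rfl
    | cons w L₂ =>
      obtain ⟨i, rfl⟩ := h₂ w (by simp)
      exact absurd h.symm (by simp [U.code_ne_nil i])
  | cons v L₁ ih =>
    intro L₂ h₁ h₂ h
    obtain ⟨i, rfl⟩ := h₁ v (by simp)
    cases L₂ with
    | nil => exact absurd h (by simp [U.code_ne_nil i])
    | cons w L₂ =>
      obtain ⟨j, rfl⟩ := h₂ w (by simp)
      rw [List.flatten_cons, List.flatten_cons] at h
      have hij : i = j := by
        rcases List.prefix_or_prefix_of_prefix (List.prefix_append _ _)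
          (h ▸ List.prefix_append (U.code j) L₂.flatten) with hp | hp
        · exact U.code_prefixFree _ _ hp
        · exact (U.code_prefixFree _ _ hp).symm
      subst hij
      rw [ih L₂ (fun w hw => h₁ w (by simp [hw])) (fun w hw => h₂ w (by simp [hw]))
        (List.append_cancel_left h)]

theorem tsum_code_le_one : ∑' i, (2⁻¹ : ℝ≥0∞) ^ (U.code i).length ≤ 1 := by
  classical
  rw [ENNReal.tsum_eq_iSup_sum]
  refine iSup_le fun s => ?_
  have hs := InformationTheory.kraft_mcmillan_inequality (S := s.image U.code)
    fun L₁ L₂ h₁ h₂ h => U.uniquelyDecodable_range_code L₁ L₂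
      (fun w hw => by have := h₁ w hw; simp at this; tauto)
      (fun w hw => by have := h₂ w hw; simp at this; tauto) h
  rw [Finset.sum_image fun i _ j _ hij => U.code_injective hij] at hs
  have hp : ∀ n : ℕ, (2⁻¹ : ℝ≥0∞) ^ n = ENNReal.ofReal ((1 / Fintype.card Bool : ℝ) ^ n) :=
    fun n => by
      rw [ENNReal.ofReal_pow (by positivity), one_div, ENNReal.ofReal_inv_of_pos (by simp)]
      simp
  simp only [hp]
  rw [← ENNReal.ofReal_sum_of_nonneg fun i _ => by positivity]
  exact ENNReal.ofReal_le_one.2 hs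

theorem ofReal_prior (ν : Hist A E → ℝ) : ENNReal.ofReal (U.prior ν) =
    ∑' i : {i : ℕ // (U.enum i).semimeasure = ν}, (2⁻¹ : ℝ≥0∞) ^ (U.code i).length := by
  have hle := (ENNReal.tsum_comp_le_tsum_of_injective Subtype.val_injective
    (fun i => (2⁻¹ : ℝ≥0∞) ^ (U.code i).length)
      (α := {i : ℕ // (U.enum i).semimeasure = ν})).trans U.tsum_code_le_one
  rw [← ENNReal.ofReal_toReal (hle.trans_lt ENNReal.one_lt_top).ne, prior,
    ENNReal.tsum_toReal_eq fun i => by simp]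
  simp

/-- The universal mixture as a sum over the indices of the machines. -/
noncomputable def indexMixture (h : Hist A E) : ℝ≥0∞ :=
  ∑' i, (2⁻¹ : ℝ≥0∞) ^ (U.code i).length * ENNReal.ofReal ((U.enum i).semimeasure h)

theorem tsum_prior_mul [Fintype E] (h : Hist A E) :
    ∑' ν : {ν : Hist A E → ℝ // IsLSCCCS ν}, ENNReal.ofReal (U.prior ν.1 * ν.1 h) =
      U.indexMixture h := by
  let g : ℕ → {ν : Hist A E → ℝ // IsLSCCCS ν} := fun i =>
    ⟨(U.enum i).semimeasure, (U.enum i).isLSCCCS_semimeasure⟩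
  rw [indexMixture, ← ENNReal.tsum_fiberwise _ g]
  refine tsum_congr fun ν => ?_
  rw [ENNReal.ofReal_mul' (ν.2.nonneg h), ofReal_prior, ← ENNReal.tsum_mul_right]
  let e : {i : ℕ // (U.enum i).semimeasure = ν.1} ≃ (g ⁻¹' {ν} : Set ℕ) :=
    Equiv.subtypeEquivRight fun i => by simp [g, Subtype.ext_iff]
  rw [← e.tsum_eq]
  refine tsum_congr fun i => ?_
  rw [show (e i : ℕ) = i from rfl, i.2]

theorem indexMixture_ne_top (h : Hist A E) : U.indexMixture h ≠ ∞ := by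
  refine ((ENNReal.tsum_le_tsum fun i => ?_).trans_lt
    (U.tsum_code_le_one.trans_lt ENNReal.one_lt_top)).ne
  exact mul_le_of_le_one_right' ((U.enum i).ofReal_semimeasure_le_one h)

variable [Fintype E]

theorem mixture_eq (h : Hist A E) : U.mixture h = (U.indexMixture h).toReal := by
  have hnn : ∀ ν, 0 ≤ U.prior ν := fun ν => tsum_nonneg fun i => by positivity
  rw [← tsum_prior_mul, ENNReal.tsum_toReal_eq fun ν => ENNReal.ofReal_ne_top, mixture]
  exact tsum_congr fun ν => (ENNReal.toReal_ofReal (mul_nonneg (hnn _) (ν.2.nonneg h))).symm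

theorem ofReal_mixture (h : Hist A E) : ENNReal.ofReal (U.mixture h) = U.indexMixture h := by
  rw [mixture_eq, ENNReal.ofReal_toReal (U.indexMixture_ne_top h)]

theorem mixture_nonneg (h : Hist A E) : 0 ≤ U.mixture h :=
  U.mixture_eq h ▸ ENNReal.toReal_nonneg

theorem sum_mixture_le (h : Hist A E) (a : A) : ∑ e, U.mixture (h ++ [(a, e)]) ≤ U.mixture h := by
  refine sum_le_of_sum_ofReal_le U.mixture_nonneg ?_
  simp only [ofReal_mixture, indexMixture]
  rw [← Summable.tsum_finsetSum fun _ _ => ENNReal.summable]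
  refine ENNReal.tsum_le_tsum fun i => ?_
  rw [← Finset.mul_sum]
  gcongr
  exact (U.enum i).sum_ofReal_semimeasure_le h a

theorem isLSC_mixture : IsLSC fun h => ENNReal.ofReal (U.mixture h) := by
  have hc : Computable fun z : Hist A E × ℕ => (z.2, z.1) := Computable.snd.pair Computable.fst
  exact ((isLSC_inv_two_pow (Computable.list_length.comp
    (U.code_computable.comp Computable.snd))).mul
      ((isLSC_semimeasure U.enum_re).comp hc)).tsum_nat.of_eq fun h => (U.ofReal_mixture h).symm

end UniversalMachine

end Semimeasure

theorem isLSC_lifetimeDiscount :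
    IsLSC fun x : ℕ × ℕ => ENNReal.ofReal (lifetimeDiscount x.1 x.2) := by
  classical
  have hp : ComputablePred fun x : ℕ × ℕ => x.2 ≤ x.1 :=
    Primrec.nat_le.computablePred_comp Computable.snd Computable.fst
  refine (IsLSC.indicator (SigmaPred.of_computablePred hp)).of_eq fun x => ?_
  rw [lifetimeDiscount]
  split_ifs <;> simp

theorem lifetimeDiscount_nonneg (m t : ℕ) : 0 ≤ lifetimeDiscount m t := by
  rw [lifetimeDiscount]
  split_ifs <;> norm_num

theorem summable_lifetimeDiscount (m : ℕ) : Summable (lifetimeDiscount m) :=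
  summable_of_ne_finset_zero (s := Finset.range (m + 1)) fun _ ht =>
    if_neg fun h => ht (Finset.mem_range.2 (Nat.lt_succ_of_le h))

section Main

variable {A E : Type*} [Fintype E] [Finite A] [Nonempty A] [Primcodable A] [Primcodable E]

omit [Fintype E] [Finite A] [Nonempty A] in
theorem isDelta_policyGraph {n : ℕ} {π : ℕ → Policy A E} (h : DeltaPred n (policyFamilyGraph π)) :
    IsDelta n (policyGraph (π 0)) :=
  (h.comp (f := fun x : Hist A E × A => (0, x.1, x.2))
    ((Computable.const 0).pair Computable.id)).isDelta

theorem exists_isDelta_policies {r : E → ℝ} (hr : ∀ e, 0 ≤ r e ∧ r e ≤ 1)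
    (hr_lsc : LowerSemicomputable r) {ν : Hist A E → ℝ} (hν : ∀ h, 0 ≤ ν h)
    (hν_sum : ∀ h a, ∑ e, ν (h ++ [(a, e)]) ≤ ν h) (hν_lsc : IsLSC fun h => ENNReal.ofReal (ν h)) :
    (∀ γ : ℕ → ℝ, IsDiscount γ →
      (∃ π : Policy A E, IsOptimal r γ ν π ∧ IsDelta 3 (policyGraph π)) ∧
      (∀ ε : ℝ, 0 < ε →
        ∃ π : Policy A E, IsEpsOptimal r γ ν ε π ∧ IsDelta 2 (policyGraph π))) ∧
    (∃ π : ℕ → Policy A E, (∀ m, IsOptimal r (lifetimeDiscount m) ν (π m)) ∧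
      IsDelta 3 (policyFamilyGraph π)) ∧
    (∀ ε : ℝ, 0 < ε →
      ∃ π : ℕ → Policy A E, (∀ m, IsEpsOptimal r (lifetimeDiscount m) ν ε (π m)) ∧
        IsDelta 2 (policyFamilyGraph π)) := by
  refine ⟨fun γ hγ => ?_, ?_, fun ε hε => ?_⟩
  · have hγ_lsc : IsLSC fun x : ℕ × ℕ => ENNReal.ofReal (γ x.2) :=
      hγ.lsc.isLSC.comp Computable.snd
    constructor
    · obtain ⟨π, hπ, hd⟩ := exists_optimal_policies hr hr_lsc (γ := fun _ => γ)
        (fun _ => hγ.nonneg) (fun _ => hγ.summable) hγ_lsc hν hν_sum hν_lsc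
      exact ⟨π 0, hπ 0, isDelta_policyGraph hd⟩
    · intro ε hε
      obtain ⟨π, hπ, hd⟩ := exists_epsOptimal_policies hr hr_lsc (γ := fun _ => γ)
        (fun _ => hγ.nonneg) (fun _ => hγ.summable) hγ_lsc hν hν_sum hν_lsc hε
      exact ⟨π 0, hπ 0, isDelta_policyGraph hd⟩
  · obtain ⟨π, hπ, hd⟩ := exists_optimal_policies hr hr_lsc lifetimeDiscount_nonneg
      summable_lifetimeDiscount isLSC_lifetimeDiscount hν hν_sum hν_lsc
    exact ⟨π, hπ, hd.isDelta⟩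
  · obtain ⟨π, hπ, hd⟩ := exists_epsOptimal_policies hr hr_lsc lifetimeDiscount_nonneg
      summable_lifetimeDiscount isLSC_lifetimeDiscount hν hν_sum hν_lsc hε
    exact ⟨π, hπ, hd.isDelta⟩

end Main

theorem mainTheorem1 {A E : Type*} [Fintype A] [Nonempty A] [Fintype E]
    [Primcodable A] [Primcodable E]
    (r : E → ℝ) (hr : ∀ e, 0 ≤ r e ∧ r e ≤ 1) (hr_lsc : LowerSemicomputable r) :
    -- recursive AINU, for every environment
    (∀ ν : Hist A E → ℝ, IsLSCCCS ν →
      (∀ γ : ℕ → ℝ, IsDiscount γ →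
        (∃ π : Policy A E, IsOptimal r γ ν π ∧ IsDelta 3 (policyGraph π)) ∧
        (∀ ε : ℝ, 0 < ε →
          ∃ π : Policy A E, IsEpsOptimal r γ ν ε π ∧ IsDelta 2 (policyGraph π))) ∧
      (∃ π : ℕ → Policy A E, (∀ m, IsOptimal r (lifetimeDiscount m) ν (π m)) ∧
        IsDelta 3 (policyFamilyGraph π)) ∧
      (∀ ε : ℝ, 0 < ε →
        ∃ π : ℕ → Policy A E, (∀ m, IsEpsOptimal r (lifetimeDiscount m) ν ε (π m)) ∧
          IsDelta 2 (policyFamilyGraph π))) ∧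
    -- recursive AIXI, for every universal machine
    (∀ U : UniversalMachine A E,
      (∀ γ : ℕ → ℝ, IsDiscount γ →
        (∃ π : Policy A E, IsOptimal r γ U.mixture π ∧ IsDelta 3 (policyGraph π)) ∧
        (∀ ε : ℝ, 0 < ε →
          ∃ π : Policy A E, IsEpsOptimal r γ U.mixture ε π ∧
            IsLimitComputable (policyGraph π))) ∧
      (∃ π : ℕ → Policy A E, (∀ m, IsOptimal r (lifetimeDiscount m) U.mixture (π m)) ∧
        IsDelta 3 (policyFamilyGraph π)) ∧
      (∀ ε : ℝ, 0 < ε →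
        ∃ π : ℕ → Policy A E, (∀ m, IsEpsOptimal r (lifetimeDiscount m) U.mixture ε (π m)) ∧
          IsLimitComputable (policyFamilyGraph π))) := by
  exact ⟨fun ν hν => exists_isDelta_policies hr hr_lsc hν.nonneg hν.sum_le hν.lsc.isLSC,
    fun U => exists_isDelta_policies hr hr_lsc U.mixture_nonneg U.sum_mixture_le U.isLSC_mixture⟩
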